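/- **Theorem 1 (single input).** Let $n\ge 1$, $A\in\mathbb{R}^{n\times n}$, $b\in\mathbb{R}^n$. Assume that $A$ has no eigenvalue with positive real part and that $(A,b)$ is stabilizable, i.e. $A-bk^T$ is Hurwitz for some $k\in\mathbb{R}^n$. Let $\mu(A)=s(A)+z(A)$, where $s(A)$ is the number of conjugate pairs of nonzero purely imaginary eigenvalues of $A$ (counted with algebraic multiplicity) and $z(A)$ is the algebraic multiplicity of the eigenvalue $0$ (zero if $0$ is not an eigenvalue). Then for every integer $p\ge 0$ and all positive real numbers $R_0,\dots,R_p$ there are vectors $k_1,\dots,k_{\mu(A)}\in\mathbb{R}^n$ and matrices $T_1,\dots,T_{\mu(A)}\in\mathbb{R}^{n\times n}$ such that the feedback $$\nu(x)=-\sum_{j=1}^{\mu(A)}\frac{k_j^Tx}{(1+\|T_jx\|^2)^{1/2}}$$ ($\nu=0$ if $\mu(A)=0$; $\|\cdot\|$ is the Euclidean norm) has the following properties. 1. *$p$-boundedness.* $\nu$ is of class $C^p$ and, for every trajectory $x:[0,\infty)\to\mathbb{R}^n$ of the closed-loop system $\dot x=Ax+b\,\nu(x)$, the control signal $U(t)=\nu(x(t))$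 is $C^p$ on $[0,\infty)$ and satisfies $|U^{(j)}(t)|\le R_j$ for all $t\ge 0$ and $0\le j\le p$. 2. *$SISS_L$-stabilization.* The origin of $\dot x=Ax+b\,\nu(x)$ is globally asymptotically stable (trajectories exist on $[0,\infty)$ from every initial state, the origin is Lyapunov stable, and every trajectory converges to it). Moreover, the closed-loop system has the small-input small-state property with linear gain: there are $\Delta,N>0$ such that, for every $\delta\in(0,\Delta]$ and every bounded measurable $e:[0,\infty)\to\mathbb{R}^n$ with $\|e(t)\|\le\delta$ for all sufficiently large $t$, the system $\dot x=Ax+b\,\nu(x)+e(t)$ has (Carathéodory) solutions on $[0,\infty)$ from every initial state, and every such solution satisfies $\|x(t)\|\le N\delta$ for all sufficiently large $t$. -/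

import Mathlib

open Filter Topology MeasureTheory

noncomputable section

namespace BoundedDerivatives

/-! ### Linear data: Hurwitz matrices, stabilizability, counting critical eigenvalues -/

/-- The complexification of a real square matrix. -/
def complexify {n : ℕ} (M : Matrix (Fin n) (Fin n) ℝ) : Matrix (Fin n) (Fin n) ℂ :=
  M.map (fun r : ℝ => (r : ℂ))

/-- All complex eigenvalues of the real matrix `M` have negative real part. -/
def IsHurwitz {n : ℕ} (M : Matrix (Fin n) (Fin n) ℝ) : Prop :=
  ∀ z : ℂ, z ∈ spectrum ℂ (complexify M) → z.re < 0

/-- No complex eigenvalue of the real matrix `M` has positive real part. -/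
def NoEigenvalueWithPosRe {n : ℕ} (M : Matrix (Fin n) (Fin n) ℝ) : Prop :=
  ∀ z : ℂ, z ∈ spectrum ℂ (complexify M) → ¬ 0 < z.re

/-- The single-input pair `(A, b)` is stabilizable: some linear feedback `u = - kᵀ x` makes the
closed-loop matrix `A - b kᵀ` Hurwitz. -/
def IsStabilizable {n : ℕ} (A : Matrix (Fin n) (Fin n) ℝ) (b : EuclideanSpace ℝ (Fin n)) : Prop :=
  ∃ k : EuclideanSpace ℝ (Fin n),
    IsHurwitz (A - Matrix.vecMulVec (fun i => b i) (fun i => k i))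

open Classical in
/-- The number of conjugate pairs of nonzero purely imaginary eigenvalues of `A`, counted with
algebraic multiplicity (each pair is counted through its member in the upper half plane). -/
def numImaginaryPairs {n : ℕ} (A : Matrix (Fin n) (Fin n) ℝ) : ℕ :=
  Multiset.card ((complexify A).charpoly.roots.filter (fun z : ℂ => z.re = 0 ∧ 0 < z.im))

/-- The algebraic multiplicity of the eigenvalue zero of `A` (it is `0` if `A` is invertible). -/
def zeroMultiplicity {n : ℕ} (A : Matrix (Fin n) (Fin n) ℝ) : ℕ :=
  A.charpoly.rootMultiplicity 0

/-- The number `μ(A) = s(A) + z(A)`. -/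
def numCriticalBlocks {n : ℕ} (A : Matrix (Fin n) (Fin n) ℝ) : ℕ :=
  numImaginaryPairs A + zeroMultiplicity A

/-- The right-hand side `(x, u) ↦ A x + b u` of a single-input linear control system. -/
def linearSystem {n : ℕ} (A : Matrix (Fin n) (Fin n) ℝ) (b : EuclideanSpace ℝ (Fin n)) :
    EuclideanSpace ℝ (Fin n) → ℝ → EuclideanSpace ℝ (Fin n) :=
  fun x u => Matrix.toEuclideanLin A x + u • b

/-- The feedback `ν(x) = - ∑ j, k_jᵀ x / (1 + ‖T_j x‖²)^{1/2}`. -/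
def satFeedback {n m : ℕ} (k : Fin m → EuclideanSpace ℝ (Fin n))
    (T : Fin m → Matrix (Fin n) (Fin n) ℝ) : EuclideanSpace ℝ (Fin n) → ℝ :=
  fun x => - ∑ j : Fin m, inner ℝ (k j) x / √(1 + ‖Matrix.toEuclideanLin (T j) x‖ ^ 2)

/-! ### Dynamical notions -/

/-- `g` is eventually bounded by `δ`. -/
def EventuallyBoundedBy {F : Type*} [Norm F] (g : ℝ → F) (δ : ℝ) : Prop :=
  ∃ t₀ : ℝ, 0 < t₀ ∧ ∀ t : ℝ, t₀ ≤ t → ‖g t‖ ≤ δ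

/-- `x` is a trajectory on `[0, ∞)` of the input-free system `ẋ = f(x)`
(one-sided derivative at time `0`; values at negative times are irrelevant). -/
def IsTrajectory {E : Type*} [NormedAddCommGroup E] [NormedSpace ℝ E] (f : E → E)
    (x : ℝ → E) : Prop :=
  ∀ t : ℝ, 0 ≤ t → HasDerivWithinAt x (f (x t)) (Set.Ici 0) t

/-- `x` is a (Carathéodory) solution on `[0, ∞)` of `ẋ = f(x, e)` for the input signal `e`:
it is continuous and satisfies the integral equation, with a locally integrable right-hand side.
Equivalently, `x` is locally absolutely continuous and `ẋ(t) = f(x(t), e(t))` for almost every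
`t ≥ 0`. -/
def IsCaratheodorySolution {E F : Type*} [NormedAddCommGroup E] [NormedSpace ℝ E]
    (f : E → F → E) (e : ℝ → F) (x : ℝ → E) : Prop :=
  ContinuousOn x (Set.Ici 0) ∧
    ∀ t : ℝ, 0 ≤ t →
      IntervalIntegrable (fun s => f (x s) (e s)) volume 0 t ∧
        x t = x 0 + ∫ s in (0 : ℝ)..t, f (x s) (e s)

/-- The control system `ẋ = f(x, u)` is `SISS_L(Δ, N)`: for every `δ ∈ (0, Δ]` and every bounded
measurable signal `e` on `[0, ∞)` that is eventually bounded by `δ`, solutions of `ẋ = f(x, e)`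
exist on `[0, ∞)` for every initial state, and every solution is eventually bounded by `N δ`.
(Lebesgue measurability of `e` on `[0, ∞)` is `AEMeasurable` for the restricted Lebesgue
measure.) -/
def IsSISSLWith {E F : Type*} [NormedAddCommGroup E] [NormedSpace ℝ E]
    [NormedAddCommGroup F] [MeasurableSpace F] (f : E → F → E) (Δ N : ℝ) : Prop :=
  ∀ δ : ℝ, 0 < δ → δ ≤ Δ → ∀ e : ℝ → F,
    AEMeasurable e (volume.restrict (Set.Ici (0 : ℝ))) →
    (∃ M : ℝ, ∀ t : ℝ, 0 ≤ t → ‖e t‖ ≤ M) →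
    EventuallyBoundedBy e δ →
    (∀ x₀ : E, ∃ x : ℝ → E, IsCaratheodorySolution f e x ∧ x 0 = x₀) ∧
      ∀ x : ℝ → E, IsCaratheodorySolution f e x → EventuallyBoundedBy x (N * δ)

/-- The control system `ẋ = f(x, u)` is `SISS_L`. -/
def IsSISSL {E F : Type*} [NormedAddCommGroup E] [NormedSpace ℝ E]
    [NormedAddCommGroup F] [MeasurableSpace F] (f : E → F → E) : Prop :=
  ∃ Δ N : ℝ, 0 < Δ ∧ 0 < N ∧ IsSISSLWith f Δ N

/-- The input-free system `ẋ = f(x)` is `SISS_L`: the control system `ẋ = f(x) + u` is. -/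
def IsInputFreeSISSL {E : Type*} [NormedAddCommGroup E] [NormedSpace ℝ E] [MeasurableSpace E]
    (f : E → E) : Prop :=
  IsSISSL (fun (x u : E) => f x + u)

/-- The origin of `ẋ = f(x)` is globally asymptotically stable: trajectories exist for all
nonnegative times from every initial state, the origin is (Lyapunov) stable, and every
trajectory converges to the origin. -/
def IsGAS {E : Type*} [NormedAddCommGroup E] [NormedSpace ℝ E] (f : E → E) : Prop :=
  (∀ x₀ : E, ∃ x : ℝ → E, IsTrajectory f x ∧ x 0 = x₀) ∧
  (∀ ε : ℝ, 0 < ε → ∃ δ : ℝ, 0 < δ ∧ ∀ x : ℝ → E, IsTrajectory f x → ‖x 0‖ < δ →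
    ∀ t : ℝ, 0 ≤ t → ‖x t‖ < ε) ∧
  (∀ x : ℝ → E, IsTrajectory f x → Tendsto x atTop (𝓝 0))

/-- The vector field `x ↦ f(x, ν(x))` of the closed-loop system. -/
def closedLoop {E F : Type*} (f : E → F → E) (ν : E → F) : E → E :=
  fun x => f x (ν x)

/-- `ν` is a stabilizing feedback for `ẋ = f(x, u)`. -/
def IsStabilizingFeedback {E F : Type*} [NormedAddCommGroup E] [NormedSpace ℝ E]
    (f : E → F → E) (ν : E → F) : Prop :=
  IsGAS (closedLoop f ν)

/-- `ν` is an `SISS_L`-stabilizing feedback for `ẋ = f(x, u)`. -/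
def IsSISSLStabilizingFeedback {E F : Type*} [NormedAddCommGroup E] [NormedSpace ℝ E]
    [MeasurableSpace E] (f : E → F → E) (ν : E → F) : Prop :=
  IsStabilizingFeedback f ν ∧ IsInputFreeSISSL (closedLoop f ν)

/-- `ν` is a feedback law `p`-bounded by `(R_j)_{0 ≤ j ≤ p}` for `ẋ = f(x, u)`: it is of class
`C^p` and, along every trajectory `x` of the closed-loop system, the control signal
`U(t) = ν(x(t))` is `p` times continuously differentiable on `[0, ∞)` with
`‖U^{(j)}(t)‖ ≤ R_j` for all `t ≥ 0` and `0 ≤ j ≤ p`. -/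
def IsPBoundedFeedback {E F : Type*} [NormedAddCommGroup E] [NormedSpace ℝ E]
    [NormedAddCommGroup F] [NormedSpace ℝ F] (f : E → F → E) (ν : E → F)
    (p : ℕ) (R : Fin (p + 1) → ℝ) : Prop :=
  ContDiff ℝ p ν ∧
    ∀ x : ℝ → E, IsTrajectory (closedLoop f ν) x →
      ContDiffOn ℝ p (fun t => ν (x t)) (Set.Ici 0) ∧
        ∀ j : Fin (p + 1), ∀ t : ℝ, 0 ≤ t →
          ‖iteratedDerivWithin (j : ℕ) (fun s => ν (x s)) (Set.Ici 0) t‖ ≤ R j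

end BoundedDerivatives

end

/-!
The proof is an induction on `μ(A)`, the number of critical blocks of `A`.

*One step.* By the Hautus test a critical eigenvalue `iω` of a stabilizable pair yields functionals
`α, β` with `αA = -ωβ`, `βA = ωα`, `α b = 1`, `β b = 0`. The linear feedback `-αx` replaces the
factor `X² + ω²` of the characteristic polynomial by `X² + X + ω²` (`critical_step`), so `A - bα`
has one critical block less, and a saturated feedback `u` for `(A - bα, b)` exists by induction. The
feedback for `(A, b)` is `-αx / √(1 + ‖Dx‖²) + τ⁻¹ u(τx)` with `τ` large, where
`‖Dx‖² = σ²‖Cx‖² + (αx)² + (βx)²` and `C` collects the functionals of the blocks removed before.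
The current `A` contains the linear feedbacks of the blocks removed before, which are not bounded;
with those blocks included in `D`, the kernel of `D` is invariant under the matrix that the induction
started with, and the derivative of `Dx` along the closed loop is bounded by `Dx` and the input.

*Gain.* All asymptotic statements are about differentiable curves with
`‖ẋ - F x‖ ≤ δ` eventually (`EventualGain`). On the plane of `(a, b) = (αx, βx)` the function
`a² + b² + κ a b / √(1 + a² + b²)` decreases outside a ball of radius `O(ε)`, where `ε` bounds the
rest of the input (`exists_planar_gain`). Hence `Dx = O(ε)`, and the saturated term differs from
`-αx` by `O(ε³)` only (`exists_saturation_defect`). Since `ε` starts at the level `1 / τ` of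
`τ⁻¹ u(τx)`, the cubic error stays in the range in which the gain of `u` applies, and the
asymptotic bound on `x` is halved again and again until it is linear in `δ` (`exists_gain_step`).
When no critical block is left, `A` is Hurwitz and the gain follows from the Cayley–Hamilton
theorem by removing the factors `A - z` one at a time (`exists_gain_of_prod`), which makes a Jordan
form and matrix exponentials unnecessary.

*Carathéodory solutions.* A measurable disturbance `e` is removed by subtracting from `x` the
difference between a primitive of `e` and its average over a window of unit length, which is small
where `e` is (`EventualGain.of_isCaratheodorySolution`). Lyapunov stability is stability in the
first approximation, since the linearized closed loop is Hurwitz.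

*Derivatives.* Both `T_j A x` and `k_jᵀ x` factor through `T_j x`, so the points
`(1, T_j x) / √(1 + ‖T_j x‖²)` of the half-sphere solve a polynomial autonomous system, of which the
control is a linear observable. They stay in a compact set, hence all derivatives of the control
are bounded uniformly (`IsGoodDesign.exists_derivative_bound`). Replacing `T_j` by `τ T_j` divides
the control and its derivatives by `τ` and preserves everything else.
-/

namespace BoundedDerivatives

/-! ### Differential inequalities -/

/-- If `W` decreases at rate at least `c` wherever it is at least `m`, it reaches the sublevel set
`W ≤ m` in finite time and stays there. -/
theorem eventually_le_of_deriv_le_neg {W W' : ℝ → ℝ} {m c : ℝ} (hc : 0 < c)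
    (hW : ∀ᶠ t in atTop, HasDerivAt W (W' t) t)
    (hbd : ∀ᶠ t in atTop, m ≤ W t → W' t ≤ -c) : ∀ᶠ t in atTop, W t ≤ m := by
  obtain ⟨T, hT⟩ := eventually_atTop.1 (hW.and hbd)
  have hcont : ∀ a b, T ≤ a → ContinuousOn W (Set.Icc a b) := fun a b ha t ht =>
    (hT t (ha.trans ht.1)).1.continuousAt.continuousWithinAt
  obtain ⟨t₁, ht₁, hWt₁⟩ : ∃ t₁, T ≤ t₁ ∧ W t₁ ≤ m := by
    by_contra! hcon
    have hlin : ∀ t, T ≤ t → W t ≤ W T - c * (t - T) := by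
      intro t ht
      refine image_le_of_deriv_right_le_deriv_boundary (a := T) (b := t) (hcont _ _ le_rfl)
        (fun s hs => (hT s hs.1).1.hasDerivWithinAt) (B := fun s => W T - c * (s - T))
        (B' := fun _ => -c) (by simp) (by fun_prop) (fun s _ => ?_)
        (fun s hs => (hT s hs.1).2 (hcon s hs.1).le) ⟨ht, le_rfl⟩
      have := ((((hasDerivAt_id s).sub_const T).const_mul c).const_sub (W T))
      simpa using this.hasDerivWithinAt
    have h0 : 0 ≤ (W T - m) / c := div_nonneg (by linarith [hcon T le_rfl]) hc.le
    have h1 := hlin (T + (W T - m) / c) (by linarith)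
    have h2 := hcon (T + (W T - m) / c) (by linarith)
    have h3 : c * (T + (W T - m) / c - T) = W T - m := by field_simp; ring
    linarith
  filter_upwards [eventually_ge_atTop t₁] with t ht
  refine image_le_of_deriv_right_lt_deriv_boundary (a := t₁) (b := t) (hcont _ _ ht₁)
    (fun s hs => (hT s (ht₁.trans hs.1)).1.hasDerivWithinAt) (B := fun _ => m) (B' := fun _ => 0)
    hWt₁ (fun s => hasDerivAt_const s m) (fun s hs he => ?_) ⟨ht, le_rfl⟩
  have := (hT s (ht₁.trans hs.1)).2 he.ge
  linarith

/-! ### Linear systems with Hurwitz spectrum -/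

section Linear

variable {E : Type*} [NormedAddCommGroup E] [NormedSpace ℂ E]

/-- Duhamel bound for the scalar equation `ẋ = z x + (error)`. -/
theorem norm_le_exp_mul_add_of_re_neg {z : ℂ} (hz : z.re < 0) {x x' : ℝ → E} {t₀ T δ : ℝ}
    (hδ : 0 ≤ δ) (hcont : ContinuousOn x (Set.Icc t₀ T))
    (hx : ∀ t ∈ Set.Ico t₀ T, HasDerivWithinAt x (x' t) (Set.Ici t) t)
    (hbd : ∀ t ∈ Set.Ico t₀ T, ‖x' t - z • x t‖ ≤ δ) :
    ∀ t ∈ Set.Icc t₀ T, ‖x t‖ ≤ Real.exp (z.re * (t - t₀)) * ‖x t₀‖ + δ / (-z.re) := by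
  intro t ht
  set a := -z.re with ha
  have ha0 : 0 < a := by linarith
  have hexp : ∀ s : ℝ, HasDerivAt (fun s : ℝ => Complex.exp (-z * ((s - t₀ : ℝ) : ℂ)))
      (Complex.exp (-z * ((s - t₀ : ℝ) : ℂ)) * -z) s := by
    intro s
    have h1 : HasDerivAt (fun s : ℝ => ((s - t₀ : ℝ) : ℂ)) 1 s := by
      simpa using ((hasDerivAt_id s).sub_const t₀).ofReal_comp
    simpa using (h1.const_mul (-z)).cexp
  have hnorm : ∀ s : ℝ, ‖Complex.exp (-z * ((s - t₀ : ℝ) : ℂ))‖ = Real.exp (a * (s - t₀)) := by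
    intro s
    rw [Complex.norm_exp, Complex.re_mul_ofReal]
    simp [ha]
  have key := image_norm_le_of_norm_deriv_right_le_deriv_boundary (a := t₀) (b := T)
    (f := fun s => Complex.exp (-z * ((s - t₀ : ℝ) : ℂ)) • x s)
    (f' := fun s => Complex.exp (-z * ((s - t₀ : ℝ) : ℂ)) • (x' s - z • x s))
    (B := fun s => ‖x t₀‖ + δ / a * (Real.exp (a * (s - t₀)) - 1))
    (B' := fun s => δ * Real.exp (a * (s - t₀)))
    (fun s hs => ((hexp s).continuousAt.continuousWithinAt).smul (hcont s hs))
    (fun s hs => by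
      have := (hexp s).hasDerivWithinAt.smul (hx s hs)
      refine this.congr_deriv ?_
      rw [smul_sub, mul_smul, neg_smul, smul_neg]; abel)
    (by simp)
    (fun s => by
      have h := (((((hasDerivAt_id s).sub_const t₀).const_mul a).exp.sub_const 1).const_mul
        (δ / a)).const_add ‖x t₀‖
      refine h.congr_deriv ?_
      simp only [id]
      field_simp)
    (fun s hs => by
      rw [norm_smul, hnorm, mul_comm]
      exact mul_le_mul_of_nonneg_right (hbd s hs) (Real.exp_pos _).le) ht
  rw [norm_smul, hnorm] at key
  have hE : Real.exp (z.re * (t - t₀)) * Real.exp (a * (t - t₀)) = 1 := by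
    rw [← Real.exp_add, ha]; simp
  have hEp := Real.exp_pos (z.re * (t - t₀))
  have h1 := mul_le_mul_of_nonneg_left key hEp.le
  have h2 : Real.exp (z.re * (t - t₀)) * (Real.exp (a * (t - t₀)) * ‖x t‖) = ‖x t‖ := by
    rw [← mul_assoc, hE, one_mul]
  have h3 : Real.exp (z.re * (t - t₀)) * (‖x t₀‖ + δ / a * (Real.exp (a * (t - t₀)) - 1)) =
      Real.exp (z.re * (t - t₀)) * ‖x t₀‖ + δ / a * (1 - Real.exp (z.re * (t - t₀))) := by
    linear_combination (δ / a) * hE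
  have h4 := mul_nonneg (div_nonneg hδ ha0.le) hEp.le
  rw [h2, h3] at h1
  linarith

theorem eventually_norm_le_of_re_neg {z : ℂ} (hz : z.re < 0) {x x' : ℝ → E} {δ : ℝ}
    (hδ : 0 < δ) (hx : ∀ᶠ t in atTop, HasDerivAt x (x' t) t)
    (hbd : ∀ᶠ t in atTop, ‖x' t - z • x t‖ ≤ δ) :
    ∀ᶠ t in atTop, ‖x t‖ ≤ (1 + 1 / (-z.re)) * δ := by
  obtain ⟨t₀, ht₀⟩ := eventually_atTop.1 (hx.and hbd)
  have hlim : Tendsto (fun t => Real.exp (z.re * (t - t₀)) * ‖x t₀‖) atTop (𝓝 0) := by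
    have h1 : Tendsto (fun t : ℝ => z.re * (t - t₀)) atTop atBot :=
      (tendsto_atTop_add_const_right _ (-t₀) tendsto_id).const_mul_atTop_of_neg hz
    simpa using (Real.tendsto_exp_atBot.comp h1).mul_const ‖x t₀‖
  filter_upwards [eventually_ge_atTop t₀, hlim.eventually (eventually_le_nhds hδ)] with t ht hs
  have := norm_le_exp_mul_add_of_re_neg hz (T := t) hδ.le
    (fun s hs => (ht₀ s hs.1).1.continuousAt.continuousWithinAt)
    (fun s hs => (ht₀ s hs.1).1.hasDerivWithinAt) (fun s hs => (ht₀ s hs.1).2) t ⟨ht, le_rfl⟩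
  calc ‖x t‖ ≤ δ + δ / (-z.re) := by linarith
    _ = _ := by ring

variable (L : E →L[ℂ] E)

theorem commute_prod_sub_smul (l : List ℂ) :
    Commute (l.map fun z => L - z • (1 : E →L[ℂ] E)).prod L := by
  refine Commute.list_prod_left _ _ fun f hf => ?_
  obtain ⟨w, -, rfl⟩ := List.mem_map.1 hf
  exact (Commute.refl L).sub_left ((Commute.one_left L).smul_left w)

/-- The factors of an annihilating polynomial are stripped off one at a time: each
`y = (L - z₂) ⋯ (L - zᵣ) x` solves a scalar equation `ẏ = z₁ y + small`. -/
theorem exists_gain_of_prod (l : List ℂ) (hl : ∀ z ∈ l, z.re < 0) :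
    ∃ N : ℝ, 0 < N ∧ ∀ (x x' : ℝ → E) (δ : ℝ), 0 < δ →
      (∀ᶠ t in atTop, HasDerivAt x (x' t) t) → (∀ᶠ t in atTop, ‖x' t - L (x t)‖ ≤ δ) →
      (∀ᶠ t in atTop, ‖(l.map fun z => L - z • (1 : E →L[ℂ] E)).prod (x t)‖ ≤ δ) →
      ∀ᶠ t in atTop, ‖x t‖ ≤ N * δ := by
  induction l with
  | nil => exact ⟨1, one_pos, fun x x' δ _ _ _ h => by simpa using h⟩
  | cons z l ih =>
    obtain ⟨N, hN, ih⟩ := ih fun w hw => hl w (List.mem_cons_of_mem _ hw)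
    have hz : z.re < 0 := hl z List.mem_cons_self
    set P : E →L[ℂ] E := (l.map fun z => L - z • (1 : E →L[ℂ] E)).prod with hP
    have hcomm : ∀ v, P (L v) = L (P v) := DFunLike.congr_fun (commute_prod_sub_smul L l)
    have hc : 0 < 1 + 1 / (-z.re) := by
      have := one_div_pos.2 (neg_pos.2 hz); linarith
    refine ⟨N * (1 + (1 + 1 / (-z.re)) * (1 + ‖P‖)), by positivity, ?_⟩
    intro x x' δ hδ hx hbd hprod
    have hy : ∀ᶠ t in atTop, ‖P (x t)‖ ≤ (1 + 1 / (-z.re)) * ((1 + ‖P‖) * δ) := by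
      refine eventually_norm_le_of_re_neg hz (x' := fun t => P (x' t)) (by positivity)
        (hx.mono fun t ht => (P.restrictScalars ℝ).hasFDerivAt.comp_hasDerivAt t ht) ?_
      filter_upwards [hbd, hprod] with t h1 h2
      have h3 : P (x' t) - z • P (x t) =
          P (x' t - L (x t)) + (L - z • (1 : E →L[ℂ] E)) (P (x t)) := by
        simp [hcomm]
      rw [List.map_cons, List.prod_cons] at h2
      rw [h3]
      calc _ ≤ ‖P (x' t - L (x t))‖ + ‖(L - z • (1 : E →L[ℂ] E)) (P (x t))‖ := norm_add_le _ _
        _ ≤ ‖P‖ * δ + δ := add_le_add ((P.le_opNorm _).trans (by gcongr)) h2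
        _ = _ := by ring
    have := ih x x' ((1 + (1 + 1 / (-z.re)) * (1 + ‖P‖)) * δ) (by positivity) hx
      (hbd.mono fun t ht => ht.trans ?_) (hy.mono fun t ht => ht.trans ?_)
    · simpa [mul_assoc] using this
    · have : 0 ≤ (1 + 1 / (-z.re)) * (1 + ‖P‖) * δ := by positivity
      linarith
    · linarith

/-- Finite-horizon counterpart of `exists_gain_of_prod`. -/
theorem exists_bound_of_prod (l : List ℂ) (hl : ∀ z ∈ l, z.re < 0) :
    ∃ N : ℝ, 0 < N ∧ ∀ (x x' : ℝ → E) (δ T : ℝ), 0 ≤ δ → ‖x 0‖ ≤ δ →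
      ContinuousOn x (Set.Icc 0 T) →
      (∀ t ∈ Set.Ico 0 T, HasDerivWithinAt x (x' t) (Set.Ici t) t) →
      (∀ t ∈ Set.Ico 0 T, ‖x' t - L (x t)‖ ≤ δ) →
      (∀ t ∈ Set.Icc 0 T, ‖(l.map fun z => L - z • (1 : E →L[ℂ] E)).prod (x t)‖ ≤ δ) →
      ∀ t ∈ Set.Icc 0 T, ‖x t‖ ≤ N * δ := by
  induction l with
  | nil => exact ⟨1, one_pos, fun x x' δ T _ _ _ _ _ h => by simpa using h⟩
  | cons z l ih =>
    obtain ⟨N, hN, ih⟩ := ih fun w hw => hl w (List.mem_cons_of_mem _ hw)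
    have hz : z.re < 0 := hl z List.mem_cons_self
    set P : E →L[ℂ] E := (l.map fun z => L - z • (1 : E →L[ℂ] E)).prod with hP
    have hcomm : ∀ v, P (L v) = L (P v) := DFunLike.congr_fun (commute_prod_sub_smul L l)
    have hc : 0 < 1 / (-z.re) := one_div_pos.2 (neg_pos.2 hz)
    refine ⟨N * (1 + (1 + 1 / (-z.re)) * (1 + ‖P‖)), by positivity, ?_⟩
    intro x x' δ T hδ h0 hcont hx hbd hprod
    have hy : ∀ t ∈ Set.Icc 0 T, ‖P (x t)‖ ≤ (1 + 1 / (-z.re)) * ((1 + ‖P‖) * δ) := by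
      intro t ht
      have h4 := norm_le_exp_mul_add_of_re_neg hz (x := fun t => P (x t))
        (x' := fun t => P (x' t)) (δ := (1 + ‖P‖) * δ) (by positivity)
        (P.continuous.comp_continuousOn hcont)
        (fun t ht => (P.restrictScalars ℝ).hasFDerivAt.comp_hasDerivWithinAt t (hx t ht)) ?_ t ht
      · have h5 : Real.exp (z.re * (t - 0)) ≤ 1 :=
          Real.exp_le_one_iff.2 (mul_nonpos_of_nonpos_of_nonneg hz.le (by linarith [ht.1]))
        have h6 : ‖P (x 0)‖ ≤ ‖P‖ * δ := (P.le_opNorm _).trans (by gcongr)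
        have h7 := mul_le_mul h5 h6 (norm_nonneg _) zero_le_one
        calc ‖P (x t)‖ ≤ (1 + ‖P‖) * δ + (1 + ‖P‖) * δ / (-z.re) := by linarith
          _ = _ := by ring
      · intro s hs
        have h2 := hprod s ⟨hs.1, hs.2.le⟩
        have h3 : P (x' s) - z • P (x s) =
            P (x' s - L (x s)) + (L - z • (1 : E →L[ℂ] E)) (P (x s)) := by
          simp [hcomm]
        rw [List.map_cons, List.prod_cons] at h2
        rw [h3]
        calc _ ≤ ‖P (x' s - L (x s))‖ + ‖(L - z • (1 : E →L[ℂ] E)) (P (x s))‖ := norm_add_le _ _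
          _ ≤ ‖P‖ * δ + δ :=
            add_le_add ((P.le_opNorm _).trans (by have := hbd s hs; gcongr)) h2
          _ = _ := by ring
    have h8 : 0 ≤ (1 + 1 / (-z.re)) * (1 + ‖P‖) * δ := by positivity
    have := ih x x' ((1 + (1 + 1 / (-z.re)) * (1 + ‖P‖)) * δ) T (by positivity)
      (h0.trans (by linarith)) hcont hx
      (fun t ht => (hbd t ht).trans (by linarith)) (fun t ht => (hy t ht).trans (by linarith))
    simpa [mul_assoc] using this

end Linear

/-! ### The critical planar block -/

/-- Decay along the comparison function: `W` is comparable to `r ^ 2` and decreases at rate at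
least `c r ^ 2 / √(1 + r ^ 2)`, up to an error `8 r ε`. -/
theorem eventually_le_of_comparison {c : ℝ} (hc : 0 < c) {W W' r : ℝ → ℝ} {ε : ℝ} (hε : 0 < ε)
    (hεc : 32 * ε ≤ c) (hr : ∀ t, 0 ≤ r t)
    (hW : ∀ᶠ t in atTop, HasDerivAt W (W' t) t)
    (hlow : ∀ t, r t ^ 2 / 2 ≤ W t) (hup : ∀ t, W t ≤ 2 * r t ^ 2)
    (hdec : ∀ᶠ t in atTop, W' t ≤ -(c * r t ^ 2 / √(1 + r t ^ 2)) + 8 * r t * ε) :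
    ∀ᶠ t in atTop, r t ≤ 64 / c * ε := by
  set r₀ := 32 / c * ε with hr₀
  have hr₀pos : 0 < r₀ := by positivity
  have hr₀le : r₀ ≤ 1 := by
    rw [hr₀, div_mul_eq_mul_div, div_le_one hc]; exact hεc
  have hcr₀ : c * r₀ = 32 * ε := by rw [hr₀]; field_simp
  have key : ∀ᶠ t in atTop, W t ≤ 2 * r₀ ^ 2 := by
    refine eventually_le_of_deriv_le_neg (c := 8 * r₀ * ε) (by positivity) hW
      (hdec.mono fun t ht hWt => ht.trans ?_)
    have h1 : r₀ ≤ r t := by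
      have := hup t
      exact (sq_le_sq₀ hr₀pos.le (hr t)).1 (by linarith)
    have hs : 0 < √(1 + r t ^ 2) := by positivity
    have h2 : r₀ * √(1 + r t ^ 2) ≤ 2 * r t := by
      have h3 : √(1 + r t ^ 2) ≤ 1 + r t := by
        rw [Real.sqrt_le_left (by linarith [hr t])]; nlinarith [hr t]
      nlinarith [hr t]
    have h4 : 16 * r t * ε ≤ c * r t ^ 2 / √(1 + r t ^ 2) := by
      rw [le_div_iff₀ hs]
      have : c * (r₀ * √(1 + r t ^ 2)) ≤ c * (2 * r t) := by gcongr
      have h5 : 32 * ε * √(1 + r t ^ 2) ≤ 2 * c * r t := by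
        rw [← hcr₀]; linarith
      nlinarith [hr t]
    nlinarith
  filter_upwards [key] with t ht
  have h1 := hlow t
  have : r t ^ 2 ≤ (2 * r₀) ^ 2 := by nlinarith
  have := (sq_le_sq₀ (hr t) (by positivity)).1 this
  calc r t ≤ 2 * r₀ := this
    _ = _ := by rw [hr₀]; ring

/-- The weight `κ = γ ω` of the cross term in `a² + b² + κ a b / √(1 + a² + b²)` is small enough to
keep that function comparable to `a² + b²`. -/
theorem abs_mul_omega_le_half {ω γ : ℝ} (hγ : γ = 1 / (2 * (ω ^ 2 + 2))) : |γ * ω| ≤ 1 / 2 := by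
  have hγ0 : 0 < γ := by rw [hγ]; positivity
  have hγ' : γ * (ω ^ 2 + 2) = 1 / 2 := by rw [hγ]; field_simp
  rw [abs_mul, abs_of_pos hγ0]
  have : |ω| ≤ ω ^ 2 + 2 := by nlinarith [sq_abs ω, sq_nonneg (|ω| - 1)]
  nlinarith

/-- The damping terms in the derivative of `a² + b² + κ a b / √(1 + a² + b²)`. -/
theorem planar_damping_le {ω γ c : ℝ} (hγ : γ = 1 / (2 * (ω ^ 2 + 2)))
    (hc : c = if ω = 0 then 1 / 2 else γ * ω ^ 2 / 2)
    {a b φ ρ : ℝ} (hb : ω ≠ 0 ∨ b = 0) (hρ : 0 < ρ) (hρ2 : ρ ^ 2 = 1 + a ^ 2 + b ^ 2)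
    (hφ1 : 1 / (2 * ρ) ≤ φ) (hφ2 : φ ≤ 1) :
    -(2 * a ^ 2 * φ) + γ * ω * ω * (a ^ 2 - b ^ 2) / ρ - γ * ω * (a * b * φ / ρ)
        + γ * ω * (a * b * (a ^ 2 * φ) / ρ ^ 3) ≤ -(c * (a ^ 2 + b ^ 2) / ρ) := by
  have hφ0 : 0 ≤ φ := le_trans (by positivity) hφ1
  have hγ0 : 0 < γ := by rw [hγ]; positivity
  have hγ' : γ * (ω ^ 2 + 2) = 1 / 2 := by rw [hγ]; field_simp
  have hM1 : a ^ 2 / ρ ≤ 2 * a ^ 2 * φ := by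
    have : 2 * a ^ 2 * (1 / (2 * ρ)) ≤ 2 * a ^ 2 * φ :=
      mul_le_mul_of_nonneg_left hφ1 (by positivity)
    calc a ^ 2 / ρ = 2 * a ^ 2 * (1 / (2 * ρ)) := by field_simp
      _ ≤ _ := this
  obtain ⟨κ, hκ⟩ : ∃ κ, κ = γ * ω := ⟨_, rfl⟩
  have hM2 : |κ * (a * b * φ / ρ)| ≤ |κ * (a * b)| / ρ := by
    rw [mul_div_assoc' κ, abs_div, abs_of_pos hρ]
    refine div_le_div_of_nonneg_right ?_ hρ.le
    rw [← mul_assoc, abs_mul _ φ, abs_of_nonneg hφ0]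
    exact mul_le_of_le_one_right (abs_nonneg _) hφ2
  have hM3 : |κ * (a * b * (a ^ 2 * φ) / ρ ^ 3)| ≤ |κ * (a * b)| / ρ := by
    have hρ3 : 0 < ρ ^ 3 := by positivity
    rw [mul_div_assoc' κ, abs_div, abs_of_pos hρ3, ← mul_assoc,
      abs_mul _ (a ^ 2 * φ), div_le_div_iff₀ hρ3 hρ, mul_assoc]
    have : |a ^ 2 * φ| ≤ ρ ^ 2 := by
      rw [abs_of_nonneg (by positivity)]
      have : a ^ 2 * φ ≤ a ^ 2 := mul_le_of_le_one_right (sq_nonneg _) hφ2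
      linarith [sq_nonneg b]
    calc |κ * (a * b)| * (|a ^ 2 * φ| * ρ) ≤ |κ * (a * b)| * (ρ ^ 2 * ρ) :=
          mul_le_mul_of_nonneg_left (mul_le_mul_of_nonneg_right this hρ.le) (abs_nonneg _)
      _ = _ := by ring
  have hM4 : 2 * |κ * (a * b)| ≤ γ * (ω ^ 2 * b ^ 2 / 2 + 2 * a ^ 2) := by
    rw [hκ, show γ * ω * (a * b) = γ * (a * (ω * b)) by ring, abs_mul, abs_of_pos hγ0, abs_mul]
    have : 2 * (|a| * |ω * b|) ≤ ω ^ 2 * b ^ 2 / 2 + 2 * a ^ 2 := by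
      rw [← mul_pow, ← sq_abs a, ← sq_abs (ω * b)]
      linarith [sq_nonneg (2 * |a| - |ω * b|)]
    calc 2 * (γ * (|a| * |ω * b|)) = γ * (2 * (|a| * |ω * b|)) := by ring
      _ ≤ _ := mul_le_mul_of_nonneg_left this hγ0.le
  have hM5 : -(a ^ 2) + κ * ω * (a ^ 2 - b ^ 2) + 2 * |κ * (a * b)| ≤ -(c * (a ^ 2 + b ^ 2)) := by
    have h1 : -(a ^ 2) + κ * ω * (a ^ 2 - b ^ 2) + 2 * |κ * (a * b)| ≤
        -(1 / 2) * a ^ 2 - γ * ω ^ 2 / 2 * b ^ 2 := by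
      have h2 : γ * ω ^ 2 * a ^ 2 + 2 * γ * a ^ 2 = 1 / 2 * a ^ 2 := by rw [← hγ']; ring
      have h3 : κ * ω * (a ^ 2 - b ^ 2) = γ * ω ^ 2 * a ^ 2 - γ * ω ^ 2 * b ^ 2 := by
        rw [hκ]; ring
      linarith
    refine h1.trans ?_
    by_cases hω : ω = 0
    · rw [if_pos hω] at hc
      rcases hb with h | h
      · exact absurd hω h
      · rw [hc, h, hω]; ring_nf; rfl
    · rw [if_neg hω] at hc
      have : c ≤ 1 / 2 := by linarith
      have := mul_le_mul_of_nonneg_right this (sq_nonneg a)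
      rw [← hc]
      linarith
  have hM6 := div_le_div_of_nonneg_right hM5 hρ.le
  have hsplit : (-(a ^ 2) + κ * ω * (a ^ 2 - b ^ 2) + 2 * |κ * (a * b)|) / ρ =
      -(a ^ 2 / ρ) + κ * ω * (a ^ 2 - b ^ 2) / ρ + 2 * (|κ * (a * b)| / ρ) := by ring
  rw [hsplit, neg_div] at hM6
  rw [← hκ]
  linarith [(abs_le.1 hM2).1, (abs_le.1 hM3).2]

/-- The perturbation terms in the derivative of `a² + b² + κ a b / √(1 + a² + b²)`. -/
theorem planar_error_le {κ : ℝ} (hκ1 : |κ| ≤ 1 / 2) {a b e₁ e₂ ε ρ : ℝ} (hρ : 0 < ρ)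
    (hρ2 : ρ ^ 2 = 1 + a ^ 2 + b ^ 2) (h₁ : |e₁| ≤ ε) (h₂ : |e₂| ≤ ε) :
    2 * (a * e₁ + b * e₂) + κ * ((b * e₁ + a * e₂) / ρ)
      - κ * (a * b * (a * e₁ + b * e₂) / ρ ^ 3) ≤ 8 * √(a ^ 2 + b ^ 2) * ε := by
  obtain ⟨r, hr⟩ : ∃ r, r = √(a ^ 2 + b ^ 2) := ⟨_, rfl⟩
  rw [← hr]
  have hr0 : 0 ≤ r := hr ▸ Real.sqrt_nonneg _
  have hr2 : r ^ 2 = a ^ 2 + b ^ 2 := by rw [hr, Real.sq_sqrt (by positivity)]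
  have hε : 0 ≤ ε := (abs_nonneg _).trans h₁
  have har : |a| ≤ r := hr ▸ Real.abs_le_sqrt (by linarith [sq_nonneg b])
  have hbr : |b| ≤ r := hr ▸ Real.abs_le_sqrt (by linarith [sq_nonneg a])
  have hρ1 : 1 ≤ ρ := by nlinarith only [hρ, hρ2, sq_nonneg a, sq_nonneg b]
  have hab' : |a * b| ≤ ρ ^ 2 := by
    have : |a * b| ≤ r ^ 2 := by
      rw [abs_mul, sq]; exact mul_le_mul har hbr (abs_nonneg _) hr0
    linarith
  have aux : ∀ u v : ℝ, |u| ≤ r → |v| ≤ r → |u * e₁ + v * e₂| ≤ 2 * r * ε := by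
    intro u v hu hv
    calc |u * e₁ + v * e₂| ≤ |u| * |e₁| + |v| * |e₂| := by
          rw [← abs_mul, ← abs_mul]; exact abs_add_le _ _
      _ ≤ r * ε + r * ε := by gcongr
      _ = _ := by ring
  have herr1 := aux a b har hbr
  have herr2 := aux b a hbr har
  have hre : 0 ≤ 2 * r * ε := by positivity
  have hE2 : |κ * ((b * e₁ + a * e₂) / ρ)| ≤ r * ε := by
    rw [abs_mul, abs_div, abs_of_pos hρ]
    have : |b * e₁ + a * e₂| / ρ ≤ 2 * r * ε := (div_le_self (abs_nonneg _) hρ1).trans herr2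
    calc _ ≤ 1 / 2 * (2 * r * ε) := by gcongr
      _ = _ := by ring
  have hE3 : |κ * (a * b * (a * e₁ + b * e₂) / ρ ^ 3)| ≤ r * ε := by
    have hρ3 : 0 < ρ ^ 3 := by positivity
    rw [abs_mul, abs_div, abs_of_pos hρ3, abs_mul (a * b)]
    have : |a * b| * |a * e₁ + b * e₂| / ρ ^ 3 ≤ 2 * r * ε := by
      rw [div_le_iff₀ hρ3]
      have h1 : |a * b| * |a * e₁ + b * e₂| ≤ ρ ^ 2 * (2 * r * ε) := by gcongr
      have h2 : ρ ^ 2 * (2 * r * ε) ≤ ρ ^ 3 * (2 * r * ε) :=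
        mul_le_mul_of_nonneg_right (pow_le_pow_right₀ hρ1 (by norm_num)) hre
      linarith
    calc _ ≤ 1 / 2 * (2 * r * ε) := by gcongr
      _ = _ := by ring
  linarith [(abs_le.1 hE2).2, (abs_le.1 hE3).1, (abs_le.1 herr1).2]

/-- Pointwise dissipation inequality for `W = a² + b² + κ a b / √(1 + a² + b²)`. -/
theorem planar_dissipation {ω γ κ c : ℝ} (hγ : γ = 1 / (2 * (ω ^ 2 + 2))) (hκ : κ = γ * ω)
    (hc : c = if ω = 0 then 1 / 2 else γ * ω ^ 2 / 2)
    {a b a' b' φ ε ρ : ℝ} (hb : ω ≠ 0 ∨ b = 0) (hρ : 0 < ρ) (hρ2 : ρ ^ 2 = 1 + a ^ 2 + b ^ 2)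
    (hφ1 : 1 / (2 * ρ) ≤ φ) (hφ2 : φ ≤ 1)
    (ha : |a' + ω * b + a * φ| ≤ ε) (hb' : |b' - ω * a| ≤ ε) :
    2 * a * a' + 2 * b * b' + κ * ((a' * b + a * b') / ρ - a * b * (a * a' + b * b') / ρ ^ 3) ≤
      -(c * (a ^ 2 + b ^ 2) / ρ) + 8 * √(a ^ 2 + b ^ 2) * ε := by
  have hκ1 : |κ| ≤ 1 / 2 := hκ ▸ abs_mul_omega_le_half hγ
  have h1 := planar_error_le hκ1 hρ hρ2 ha hb'
  have h2 := planar_damping_le hγ hc hb hρ hρ2 hφ1 hφ2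
  rw [← hκ] at h2
  have h3 := add_le_add h2 h1
  refine le_of_eq_of_le ?_ h3
  ring

/-- Input-to-state estimate for the saturated (or linearly damped, `φ = 1`) critical block. The
damping acts on `a` only; the cross term of `a² + b² + κ a b / √(1 + a² + b²)` transfers it to `b`
through the rotation `ω`. For `ω = 0` there is no such transfer, and `b` has to vanish. -/
theorem exists_planar_gain (ω : ℝ) :
    ∃ K θ : ℝ, 0 < K ∧ 0 < θ ∧ ∀ (a b a' b' : ℝ → ℝ) (ε : ℝ), 0 < ε → ε ≤ θ →
      (∀ᶠ t in atTop, HasDerivAt a (a' t) t) → (∀ᶠ t in atTop, HasDerivAt b (b' t) t) →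
      (∀ t, ω ≠ 0 ∨ b t = 0) →
      (∀ᶠ t in atTop, ∃ φ, 1 / (2 * √(1 + a t ^ 2 + b t ^ 2)) ≤ φ ∧ φ ≤ 1 ∧
        |a' t + ω * b t + a t * φ| ≤ ε) →
      (∀ᶠ t in atTop, |b' t - ω * a t| ≤ ε) →
      ∀ᶠ t in atTop, √(a t ^ 2 + b t ^ 2) ≤ K * ε := by
  obtain ⟨γ, hγ⟩ : ∃ γ, γ = 1 / (2 * (ω ^ 2 + 2)) := ⟨_, rfl⟩
  obtain ⟨κ, hκ⟩ : ∃ κ, κ = γ * ω := ⟨_, rfl⟩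
  obtain ⟨c, hc⟩ : ∃ c, c = if ω = 0 then 1 / 2 else γ * ω ^ 2 / 2 := ⟨_, rfl⟩
  have hγ0 : 0 < γ := by rw [hγ]; positivity
  have hc0 : 0 < c := by
    rw [hc]; split_ifs with h
    · norm_num
    · positivity
  have hκ1 : |κ| ≤ 1 / 2 := hκ ▸ abs_mul_omega_le_half hγ
  -- `c` is the decay rate of the comparison function, as needed in `eventually_le_of_comparison`
  refine ⟨64 / c, c / 32, by positivity, by positivity, ?_⟩
  intro a b a' b' ε hε hεθ ha hb hb0 hφ hb'
  set ρ : ℝ → ℝ := fun t => √(1 + a t ^ 2 + b t ^ 2) with hρdef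
  have hρ : ∀ t, 0 < ρ t := fun t => by simp only [hρdef]; positivity
  have hρ2 : ∀ t, ρ t ^ 2 = 1 + a t ^ 2 + b t ^ 2 := fun t => Real.sq_sqrt (by positivity)
  have hcross : ∀ t, |κ * (a t * b t / ρ t)| ≤ (a t ^ 2 + b t ^ 2) / 2 := by
    intro t
    rw [abs_mul, abs_div, abs_of_pos (hρ t), abs_mul]
    have h1 : |a t| * |b t| / ρ t ≤ |a t| * |b t| := by
      refine div_le_self (by positivity) ?_
      nlinarith [hρ2 t, hρ t, sq_nonneg (a t), sq_nonneg (b t)]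
    have h2 : |a t| * |b t| ≤ (a t ^ 2 + b t ^ 2) := by
      nlinarith [sq_nonneg (|a t| - |b t|), sq_abs (a t), sq_abs (b t)]
    have h3 : 0 ≤ |a t| * |b t| / ρ t := by have := hρ t; positivity
    calc |κ| * (|a t| * |b t| / ρ t) ≤ 1 / 2 * (a t ^ 2 + b t ^ 2) := by
          gcongr; linarith
      _ = _ := by ring
  have hr2 : ∀ t, √(a t ^ 2 + b t ^ 2) ^ 2 = a t ^ 2 + b t ^ 2 :=
    fun t => Real.sq_sqrt (by positivity)
  refine eventually_le_of_comparison hc0 (W := fun t => a t ^ 2 + b t ^ 2 + κ * (a t * b t / ρ t))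
    (W' := fun t => 2 * a t * a' t + 2 * b t * b' t + κ * ((a' t * b t + a t * b' t) / ρ t
      - a t * b t * (a t * a' t + b t * b' t) / ρ t ^ 3)) hε (by linarith)
    (fun t => Real.sqrt_nonneg _) ?_ (fun t => ?_) (fun t => ?_) ?_
  · filter_upwards [ha, hb] with t hat hbt
    have h1 : HasDerivAt ρ ((2 * a t * a' t + 2 * b t * b' t) / (2 * ρ t)) t := by
      have h2 := ((hat.pow 2).const_add 1).add (hbt.pow 2)
      refine (h2.sqrt ?_).congr_deriv ?_
      · simp only [Pi.add_apply, Pi.pow_apply]; positivity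
      · simp [hρdef]
    have h3 := ((hat.pow 2).add (hbt.pow 2)).add (((hat.mul hbt).div h1 (hρ t).ne').const_mul κ)
    refine h3.congr_deriv ?_
    have := (hρ t).ne'
    simp only [Pi.mul_apply]
    field_simp
    push_cast
    ring
  · rw [hr2]; have := abs_le.1 (hcross t); linarith
  · rw [hr2]; have := abs_le.1 (hcross t); linarith
  · filter_upwards [hφ, hb'] with t ⟨φ, h1, h2, h3⟩ h4
    have := planar_dissipation hγ hκ hc (hb0 t) (hρ t) (hρ2 t) h1 h2 h3 h4
    rw [hr2, ← add_assoc]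
    exact this

/-! ### Asymptotic gains and the elimination of one critical block -/

section Gain

variable {X : Type*} [NormedAddCommGroup X] [NormedSpace ℝ X]

/-- `ẋ = F x + (error)` has asymptotic gain `N` for errors that are eventually at most `Δ`. Only
the behaviour near infinity of a differentiable curve `x` with derivative `x'` matters. -/
def EventualGain (F : X → X) (Δ N : ℝ) : Prop :=
  ∀ (x x' : ℝ → X) (δ : ℝ), 0 < δ → δ ≤ Δ → (∀ᶠ t in atTop, HasDerivAt x (x' t) t) →
    (∀ᶠ t in atTop, ‖x' t - F (x t)‖ ≤ δ) → ∀ᶠ t in atTop, ‖x t‖ ≤ N * δ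

/-- The output `C x` of `ẋ = A x + (error)` has asymptotic gain `N` with respect to the error as
seen through `C`. When `C` spans an invariant space of functionals, this says that the quotient
dynamics on `X ⧸ ker C` are Hurwitz. -/
def StableOutput (A C : X →L[ℝ] X) (N : ℝ) : Prop :=
  ∀ (x x' : ℝ → X) (δ : ℝ), 0 < δ → (∀ᶠ t in atTop, HasDerivAt x (x' t) t) →
    (∀ᶠ t in atTop, ‖C (x' t - A (x t))‖ ≤ δ) → ∀ᶠ t in atTop, ‖C (x t)‖ ≤ N * δ

/-- A pair of functionals `α, β` spanning a left-invariant space of `A` on which `A` acts with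
eigenvalues `± i ω`, normalized by `α b = 1`, `β b = 0`; for `ω = 0` it reduces to a single left
null functional `α`. -/
structure CriticalPair (A : X →L[ℝ] X) (b : X) (ω : ℝ) (α β : X →L[ℝ] ℝ) : Prop where
  apply_left : ∀ x, α (A x) = -ω * β x
  apply_right : ∀ x, β (A x) = ω * α x
  left_input : α b = 1
  right_input : β b = 0
  ne_zero_or : ω ≠ 0 ∨ β = 0

/-- Rescaling the state divides the admissible level of the error by `τ` and keeps the gain. -/
theorem EventualGain.scale {A : X →L[ℝ] X} {b : X} {u : X → ℝ} {Δ N τ : ℝ} (hτ : 0 < τ)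
    (h : EventualGain (fun x => A x + u x • b) Δ N) :
    EventualGain (fun x => A x + (τ⁻¹ * u (τ • x)) • b) (Δ / τ) N := by
  intro x x' δ hδ hδΔ hx hbd
  have := h (fun t => τ • x t) (fun t => τ • x' t) (τ * δ) (by positivity)
    (by rwa [le_div_iff₀' hτ] at hδΔ) (hx.mono fun t ht => ht.const_smul τ) ?_
  · filter_upwards [this] with t ht
    rw [norm_smul, Real.norm_of_nonneg hτ.le, mul_left_comm] at ht
    exact le_of_mul_le_mul_left ht hτ
  · filter_upwards [hbd] with t ht
    have h1 : τ • x' t - (A (τ • x t) + u (τ • x t) • b) =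
        τ • (x' t - (A (x t) + (τ⁻¹ * u (τ • x t)) • b)) := by
      rw [smul_sub, smul_add, smul_smul, ← mul_assoc, mul_inv_cancel₀ hτ.ne', one_mul, map_smul]
    rw [h1, norm_smul, Real.norm_of_nonneg hτ.le]
    gcongr

variable {A C D : X →L[ℝ] X} {b : X} {ω σ N : ℝ} {α β : X →L[ℝ] ℝ}

/-- In this and the following lemmas `D` collects the output `C`, weighted by `σ`, and the two
functionals `α, β`. -/
theorem abs_left_le_norm_output
    (hD : ∀ x, ‖D x‖ ^ 2 = σ ^ 2 * ‖C x‖ ^ 2 + α x ^ 2 + β x ^ 2) (x : X) :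
    |α x| ≤ ‖D x‖ :=
  abs_le_of_sq_le_sq
    (by rw [hD]; nlinarith [sq_nonneg (σ * ‖C x‖), sq_nonneg (β x)]) (norm_nonneg _)

theorem abs_right_le_norm_output
    (hD : ∀ x, ‖D x‖ ^ 2 = σ ^ 2 * ‖C x‖ ^ 2 + α x ^ 2 + β x ^ 2) (x : X) :
    |β x| ≤ ‖D x‖ :=
  abs_le_of_sq_le_sq
    (by rw [hD]; nlinarith [sq_nonneg (σ * ‖C x‖), sq_nonneg (α x)]) (norm_nonneg _)

theorem mul_norm_le_norm_output (hσ : 0 < σ)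
    (hD : ∀ x, ‖D x‖ ^ 2 = σ ^ 2 * ‖C x‖ ^ 2 + α x ^ 2 + β x ^ 2) (x : X) :
    σ * ‖C x‖ ≤ ‖D x‖ :=
  (sq_le_sq₀ (by positivity) (norm_nonneg _)).1
    (by rw [hD, mul_pow]; linarith [sq_nonneg (α x), sq_nonneg (β x)])

theorem norm_output_le (hσ : 0 < σ)
    (hD : ∀ x, ‖D x‖ ^ 2 = σ ^ 2 * ‖C x‖ ^ 2 + α x ^ 2 + β x ^ 2) (x : X) :
    ‖D x‖ ≤ σ * ‖C x‖ + |α x| + |β x| := by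
  refine (sq_le_sq₀ (norm_nonneg _) (by positivity)).1 ?_
  rw [hD, ← sq_abs (α x), ← sq_abs (β x)]
  have e1 : 0 ≤ σ * ‖C x‖ := by positivity
  nlinarith only [mul_nonneg e1 (abs_nonneg (α x)), mul_nonneg e1 (abs_nonneg (β x)),
    mul_nonneg (abs_nonneg (α x)) (abs_nonneg (β x))]

/-- If `ker C` is `A`-invariant, so is `ker D`. -/
theorem CriticalPair.exists_norm_output_le (hc : CriticalPair A b ω α β) (hω : 0 ≤ ω)
    (hσ : 0 < σ) (hD : ∀ x, ‖D x‖ ^ 2 = σ ^ 2 * ‖C x‖ ^ 2 + α x ^ 2 + β x ^ 2)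
    {K : ℝ} (hK : 0 < K) (hCA : ∀ x, ‖C (A x)‖ ≤ K * ‖C x‖) :
    ∃ K', 0 < K' ∧ ∀ x, ‖D (A x)‖ ≤ K' * ‖D x‖ := by
  refine ⟨K + 2 * ω, by positivity, fun x => (norm_output_le hσ hD _).trans ?_⟩
  rw [hc.apply_left, hc.apply_right, abs_mul, abs_mul, abs_neg, abs_of_nonneg hω]
  have e1 : σ * ‖C (A x)‖ ≤ K * ‖D x‖ := by
    calc _ ≤ σ * (K * ‖C x‖) := by gcongr; exact hCA x
      _ = K * (σ * ‖C x‖) := by ring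
      _ ≤ _ := by gcongr; exact mul_norm_le_norm_output hσ hD x
  have e2 := mul_le_mul_of_nonneg_left (abs_left_le_norm_output hD x) hω
  have e3 := mul_le_mul_of_nonneg_left (abs_right_le_norm_output hD x) hω
  linarith

theorem exists_norm_output_sub_le (hα : ∀ x, |α x| ≤ ‖D x‖) {K : ℝ} (hK : 0 < K)
    (hDA : ∀ x, ‖D (A x)‖ ≤ K * ‖D x‖) :
    ∃ K', 0 < K' ∧ ∀ x, ‖D ((A - α.smulRight b) x)‖ ≤ K' * ‖D x‖ := by
  refine ⟨K + ‖D b‖, by positivity, fun x => ?_⟩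
  have e : (A - α.smulRight b) x = A x - α x • b := rfl
  rw [e, map_sub, map_smul]
  refine (norm_sub_le _ _).trans ?_
  rw [norm_smul, Real.norm_eq_abs, add_mul, mul_comm |α x|]
  exact add_le_add (hDA x) (mul_le_mul_of_nonneg_left (hα x) (norm_nonneg _))

/-- The linear feedback `-α x` renders the critical block Hurwitz, so that the output `D`
collecting `C` and the block is stable for `A - b α`. -/
theorem StableOutput.extend (hc : CriticalPair A b ω α β) (hN : 0 < N) (hC : StableOutput A C N)
    (hσ : 0 < σ) (hD : ∀ x, ‖D x‖ ^ 2 = σ ^ 2 * ‖C x‖ ^ 2 + α x ^ 2 + β x ^ 2) :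
    ∃ N', 0 < N' ∧ StableOutput (A - α.smulRight b) D N' := by
  obtain ⟨K, θ, hK, hθ, hplanar⟩ := exists_planar_gain ω
  have hDα := abs_left_le_norm_output hD
  have hDβ := abs_right_le_norm_output hD
  have hDC := mul_norm_le_norm_output hσ hD
  refine ⟨σ * (N * (1 / σ + K * ‖C b‖)) + K, by positivity, ?_⟩
  intro x x' δ hδ hx hbd
  have herr : ∀ t, x' t - (A - α.smulRight b) (x t) = x' t - A (x t) + α (x t) • b := by
    intro t; simp; abel
  have hsc : 0 < θ / δ := by positivity
  have hr : ∀ᶠ t in atTop, √(α (x t) ^ 2 + β (x t) ^ 2) ≤ K * δ := by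
    have := hplanar (fun t => θ / δ * α (x t)) (fun t => θ / δ * β (x t))
      (fun t => θ / δ * α (x' t)) (fun t => θ / δ * β (x' t)) θ hθ le_rfl
      (hx.mono fun t ht => (α.hasFDerivAt.comp_hasDerivAt t ht).const_mul _)
      (hx.mono fun t ht => (β.hasFDerivAt.comp_hasDerivAt t ht).const_mul _)
      (fun t => hc.ne_zero_or.imp id fun h => by simp [h]) ?_ ?_
    · filter_upwards [this] with t ht
      rw [mul_pow, mul_pow, ← mul_add, Real.sqrt_mul (by positivity), Real.sqrt_sq hsc.le,
        div_mul_eq_mul_div, div_le_iff₀ hδ, mul_right_comm, mul_comm] at ht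
      exact le_of_mul_le_mul_right ht hθ
    · filter_upwards [hbd] with t ht
      refine ⟨1, ?_, le_rfl, ?_⟩
      · rw [div_le_one (by positivity)]
        have : 1 ≤ √(1 + (θ / δ * α (x t)) ^ 2 + (θ / δ * β (x t)) ^ 2) :=
          Real.one_le_sqrt.2 (by nlinarith [sq_nonneg (θ / δ * α (x t)), sq_nonneg (θ / δ * β (x t))])
        linarith
      · have h1 := (hDα _).trans ht
        rw [herr, map_add, map_sub, hc.apply_left, map_smul, hc.left_input] at h1
        have h2 : θ / δ * α (x' t) + ω * (θ / δ * β (x t)) + θ / δ * α (x t) * 1 =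
            θ / δ * (α (x' t) - -ω * β (x t) + α (x t) • 1) := by
          simp only [smul_eq_mul]; ring
        rw [h2, abs_mul, abs_of_pos hsc]
        calc _ ≤ θ / δ * δ := by gcongr
          _ = θ := by field_simp
    · filter_upwards [hbd] with t ht
      have h1 := (hDβ _).trans ht
      rw [herr, map_add, map_sub, hc.apply_right, map_smul, hc.right_input, smul_zero,
        add_zero] at h1
      rw [show θ / δ * β (x' t) - ω * (θ / δ * α (x t)) = θ / δ * (β (x' t) - ω * α (x t)) by ring,
        abs_mul, abs_of_pos hsc]
      calc _ ≤ θ / δ * δ := by gcongr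
        _ = θ := by field_simp
  have hα : ∀ᶠ t in atTop, |α (x t)| ≤ K * δ := hr.mono fun t ht =>
    (Real.abs_le_sqrt (by nlinarith [sq_nonneg (β (x t))])).trans ht
  have hCx := hC x x' ((1 / σ + K * ‖C b‖) * δ) (by positivity) hx (by
    filter_upwards [hbd, hα] with t h1 h2
    have h3 : x' t - A (x t) = (x' t - (A - α.smulRight b) (x t)) - α (x t) • b := by
      rw [herr]; abel
    have h4 := (hDC (x' t - (A - α.smulRight b) (x t))).trans h1
    rw [← le_div_iff₀' hσ] at h4
    rw [h3, map_sub, map_smul]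
    calc _ ≤ ‖C (x' t - (A - α.smulRight b) (x t))‖ + ‖α (x t) • C b‖ := norm_sub_le _ _
      _ ≤ δ / σ + K * δ * ‖C b‖ := by
        rw [norm_smul, Real.norm_eq_abs]; gcongr
      _ = _ := by ring)
  filter_upwards [hCx, hr] with t h1 h2
  refine (sq_le_sq₀ (norm_nonneg _) (by positivity)).1 ?_
  have h3 : α (x t) ^ 2 + β (x t) ^ 2 ≤ (K * δ) ^ 2 := by
    rw [← Real.sqrt_le_left (by positivity)]; exact h2
  have h4 : (σ * ‖C (x t)‖) ^ 2 ≤ (σ * (N * ((1 / σ + K * ‖C b‖) * δ))) ^ 2 := by gcongr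
  rw [hD, ← mul_pow]
  have h5 : 0 ≤ (σ * (N * ((1 / σ + K * ‖C b‖) * δ))) * (K * δ) := by positivity
  calc (σ * ‖C (x t)‖) ^ 2 + α (x t) ^ 2 + β (x t) ^ 2
      ≤ (σ * (N * ((1 / σ + K * ‖C b‖) * δ))) ^ 2 + (K * δ) ^ 2 := by linarith
    _ ≤ (σ * (N * ((1 / σ + K * ‖C b‖) * δ)) + K * δ) ^ 2 := by rw [add_sq]; linarith
    _ = _ := by ring

theorem one_sub_inv_sqrt_le (d : ℝ) (hd : 0 ≤ d) :
    0 ≤ 1 - 1 / √(1 + d) ∧ 1 - 1 / √(1 + d) ≤ d := by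
  have hs : 1 ≤ √(1 + d) := Real.one_le_sqrt.2 (by linarith)
  have hs0 : 0 < √(1 + d) := by linarith
  have h10 : √(1 + d) ≤ 1 + d := by
    rw [Real.sqrt_le_left (by positivity)]; nlinarith
  have e : 1 - 1 / √(1 + d) = (√(1 + d) - 1) / √(1 + d) := by rw [sub_div, div_self hs0.ne']
  rw [e]
  exact ⟨div_nonneg (by linarith) hs0.le, (div_le_self (by linarith) hs).trans (by linarith)⟩

/-- Along the loop closed by the saturated term `-α x / √(1 + ‖D x‖²)` and a small extra input
`v x`, the critical block and the output `C x` become `O(ε)`; the saturated term then differs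
from the linear feedback `-α x` by `O(ε³)` only. -/
theorem exists_saturation_defect (hc : CriticalPair A b ω α β) (hN : 0 < N)
    (hC : StableOutput A C N) :
    ∃ σ, 0 < σ ∧ ∃ Q θ, 0 ≤ Q ∧ 0 < θ ∧ ∀ D : X →L[ℝ] X,
      (∀ x, ‖D x‖ ^ 2 = σ ^ 2 * ‖C x‖ ^ 2 + α x ^ 2 + β x ^ 2) →
      ∀ (v : X → ℝ) (x x' : ℝ → X) (δ ε : ℝ), 0 < δ → δ ≤ ε → ε ≤ θ →
        (∀ᶠ t in atTop, HasDerivAt x (x' t) t) →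
        (∀ᶠ t in atTop,
          ‖x' t - (A (x t) + (-(α (x t) / √(1 + ‖D (x t)‖ ^ 2)) + v (x t)) • b)‖ ≤ δ) →
        (∀ᶠ t in atTop, |v (x t)| + (‖α‖ + ‖β‖) * δ ≤ ε) →
        ∀ᶠ t in atTop,
          ‖x' t - ((A - α.smulRight b) (x t) + v (x t) • b)‖ ≤ δ + Q * ε ^ 3 := by
  obtain ⟨K, θ, hK, hθ, hplanar⟩ := exists_planar_gain ω
  obtain ⟨M₀, hM₀⟩ : ∃ M, M = ‖C‖ * (1 + 2 * ‖b‖) + 1 := ⟨_, rfl⟩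
  obtain ⟨M₁, hM₁⟩ : ∃ M, M = ‖C‖ * (1 + (K + 1) * ‖b‖) + 1 := ⟨_, rfl⟩
  have hM₀pos : 0 < M₀ := by rw [hM₀]; positivity
  have hM₁pos : 0 < M₁ := by rw [hM₁]; positivity
  obtain ⟨σ, hσdef⟩ : ∃ σ, σ = 1 / (N * M₀) := ⟨_, rfl⟩
  have hσ : 0 < σ := by rw [hσdef]; positivity
  refine ⟨σ, hσ, K * ((σ * (N * M₁)) ^ 2 + K ^ 2) * ‖b‖, min θ 1, by positivity, by positivity, ?_⟩
  intro D hD v x x' δ ε hδ hδε hεθ hx hbd hv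
  have hε : 0 < ε := hδ.trans_le hδε
  have hε1 : ε ≤ 1 := hεθ.trans (min_le_right _ _)
  have hDα := abs_left_le_norm_output hD
  have hs : ∀ x, 0 < √(1 + ‖D x‖ ^ 2) := fun x => by positivity
  have hs1 : ∀ x, 1 ≤ √(1 + ‖D x‖ ^ 2) := fun x =>
    Real.one_le_sqrt.2 (by linarith [sq_nonneg ‖D x‖])
  have hsatα : ∀ x, |α x / √(1 + ‖D x‖ ^ 2)| ≤ |α x| := fun x => by
    rw [abs_div, abs_of_pos (hs x)]; exact div_le_self (abs_nonneg _) (hs1 x)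
  have hsat1 : ∀ x, |α x / √(1 + ‖D x‖ ^ 2)| ≤ 1 := fun x => by
    rw [abs_div, abs_of_pos (hs x), div_le_one (hs x)]
    exact (hDα x).trans (Real.le_sqrt_of_sq_le (by linarith))
  have hv' : ∀ᶠ t in atTop, |v (x t)| ≤ ε := hv.mono fun t ht => by
    have : 0 ≤ (‖α‖ + ‖β‖) * δ := by positivity
    linarith
  -- a bound on the total control is turned into a bound on `C x`
  have hCgain : ∀ B : ℝ, 0 ≤ B → (∀ᶠ t in atTop, |α (x t) / √(1 + ‖D (x t)‖ ^ 2)| ≤ B) →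
      ∀ᶠ t in atTop, ‖C (x' t - A (x t))‖ ≤ ‖C‖ * (ε + (B + ε) * ‖b‖) := by
    intro B hB hBt
    filter_upwards [hbd, hv', hBt] with t h1 h2 h3
    refine (C.le_opNorm _).trans ?_
    gcongr
    have h4 : x' t - A (x t) =
        (x' t - (A (x t) + (-(α (x t) / √(1 + ‖D (x t)‖ ^ 2)) + v (x t)) • b)) +
        (-(α (x t) / √(1 + ‖D (x t)‖ ^ 2)) + v (x t)) • b := by abel
    rw [h4]
    refine (norm_add_le _ _).trans (add_le_add (h1.trans hδε) ?_)
    rw [norm_smul, Real.norm_eq_abs]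
    gcongr
    refine (abs_add_le _ _).trans ?_
    rw [abs_neg]
    exact add_le_add h3 h2
  -- The saturated term is at most `1`, so `C x` is bounded a priori, and by the choice of `σ` the
  -- weight `√(1 + ‖D x‖²)` is at most `2 √(1 + (α x)² + (β x)²)`, as the planar estimate demands.
  have hCx : ∀ᶠ t in atTop, σ * ‖C (x t)‖ ≤ 1 := by
    have h1 := hC x x' M₀ hM₀pos hx ((hCgain 1 zero_le_one (Eventually.of_forall
      fun t => hsat1 _)).mono fun t ht => ht.trans ?_)
    · filter_upwards [h1] with t ht
      rw [hσdef, one_div_mul_eq_div, div_le_one (by positivity)]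
      exact ht
    · have : ‖C‖ * (ε + (1 + ε) * ‖b‖) ≤ ‖C‖ * (1 + (1 + 1) * ‖b‖) := by gcongr
      rw [hM₀]; linarith
  have hr := hplanar (fun t => α (x t)) (fun t => β (x t)) (fun t => α (x' t))
    (fun t => β (x' t)) ε hε (hεθ.trans (min_le_left _ _))
    (hx.mono fun t ht => α.hasFDerivAt.comp_hasDerivAt t ht)
    (hx.mono fun t ht => β.hasFDerivAt.comp_hasDerivAt t ht)
    (fun t => hc.ne_zero_or.imp id fun h => by simp [h]) (by
      filter_upwards [hCx, hbd, hv] with t h1 h2 h3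
      refine ⟨1 / √(1 + ‖D (x t)‖ ^ 2), ?_, (div_le_one (hs _)).2 (hs1 _), ?_⟩
      · refine one_div_le_one_div_of_le (hs _) ?_
        rw [Real.sqrt_le_left (by positivity), mul_pow, Real.sq_sqrt (by positivity), hD]
        have : (σ * ‖C (x t)‖) ^ 2 ≤ 1 := pow_le_one₀ (by positivity) h1
        rw [mul_pow] at this
        nlinarith [sq_nonneg (α (x t)), sq_nonneg (β (x t))]
      · have h4 := (α.le_opNorm _).trans (mul_le_mul_of_nonneg_left h2 (norm_nonneg α))
        rw [map_sub, map_add, hc.apply_left, map_smul, hc.left_input, Real.norm_eq_abs] at h4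
        have h5 : α (x' t) + ω * β (x t) + α (x t) * (1 / √(1 + ‖D (x t)‖ ^ 2)) =
            (α (x' t) - (-ω * β (x t) +
              (-(α (x t) / √(1 + ‖D (x t)‖ ^ 2)) + v (x t)) • 1)) + v (x t) := by
          simp only [smul_eq_mul]; ring
        rw [h5]
        refine (abs_add_le _ _).trans ?_
        nlinarith [norm_nonneg β])
    (by
      filter_upwards [hbd, hv] with t h2 h3
      have h4 := (β.le_opNorm _).trans (mul_le_mul_of_nonneg_left h2 (norm_nonneg β))
      rw [map_sub, map_add, hc.apply_right, map_smul, hc.right_input, smul_zero, add_zero,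
        Real.norm_eq_abs] at h4
      nlinarith [norm_nonneg α, abs_nonneg (v (x t))])
  have hα : ∀ᶠ t in atTop, |α (x t)| ≤ K * ε := hr.mono fun t ht =>
    (Real.abs_le_sqrt (by linarith [sq_nonneg (β (x t))])).trans ht
  -- Now that `α x = O(ε)`, the whole input is `O(ε)`, and so is `C x`.
  have hCx2 := hC x x' (M₁ * ε) (by positivity) hx ((hCgain (K * ε) (by positivity)
    (hα.mono fun t ht => (hsatα _).trans ht)).mono fun t ht => ht.trans (by
      rw [hM₁]; nlinarith))
  filter_upwards [hbd, hr, hα, hCx2] with t h1 h2 h3 h4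
  have h5 : α (x t) ^ 2 + β (x t) ^ 2 ≤ (K * ε) ^ 2 := by
    rw [← Real.sqrt_le_left (by positivity)]; exact h2
  have h6 : ‖D (x t)‖ ^ 2 ≤ ((σ * (N * M₁)) ^ 2 + K ^ 2) * ε ^ 2 := by
    have : (σ * ‖C (x t)‖) ^ 2 ≤ (σ * (N * (M₁ * ε))) ^ 2 := by gcongr
    rw [hD, ← mul_pow]
    calc _ ≤ (σ * (N * (M₁ * ε))) ^ 2 + (K * ε) ^ 2 := by linarith
      _ = _ := by ring
  have h7 : |α (x t) - α (x t) / √(1 + ‖D (x t)‖ ^ 2)| ≤ |α (x t)| * ‖D (x t)‖ ^ 2 := by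
    have h8 : α (x t) - α (x t) / √(1 + ‖D (x t)‖ ^ 2) =
        α (x t) * (1 - 1 / √(1 + ‖D (x t)‖ ^ 2)) := by ring
    obtain ⟨h9, h10⟩ := one_sub_inv_sqrt_le _ (sq_nonneg ‖D (x t)‖)
    rw [h8, abs_mul, abs_of_nonneg h9]
    gcongr
  have h12 : x' t - ((A - α.smulRight b) (x t) + v (x t) • b) =
      (x' t - (A (x t) + (-(α (x t) / √(1 + ‖D (x t)‖ ^ 2)) + v (x t)) • b)) +
      (α (x t) - α (x t) / √(1 + ‖D (x t)‖ ^ 2)) • b := by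
    simp [sub_smul, add_smul, neg_smul]; abel
  rw [h12]
  refine (norm_add_le _ _).trans (add_le_add h1 ?_)
  rw [norm_smul, Real.norm_eq_abs]
  calc _ ≤ (K * ε) * (((σ * (N * M₁)) ^ 2 + K ^ 2) * ε ^ 2) * ‖b‖ := by
        gcongr
        exact h7.trans (by gcongr)
    _ = _ := by ring

/-- One critical block is removed at the price of one saturated term: if `u` stabilizes
`(A - b α, b)` with asymptotic gain, a rescaled copy of `u` added to the saturated term
stabilizes `(A, b)`. The cubic defect of `exists_saturation_defect` is beaten by the level `1 / τ`
of the rescaled feedback when `τ` is large, and a contraction by the factor `1 / 2` recovers a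
linear gain. -/
theorem exists_gain_step (hc : CriticalPair A b ω α β) (hN : 0 < N) (hC : StableOutput A C N) :
    ∃ σ, 0 < σ ∧ ∀ D : X →L[ℝ] X,
      (∀ x, ‖D x‖ ^ 2 = σ ^ 2 * ‖C x‖ ^ 2 + α x ^ 2 + β x ^ 2) →
      ∀ (u : X → ℝ) (η K Δ M : ℝ), 0 < η → 0 < K → 0 < Δ → 0 < M →
        (∀ x, |u x| ≤ η) → (∀ x, |u x| ≤ K * ‖x‖) →
        EventualGain (fun x => (A - α.smulRight b) x + u x • b) Δ M →
        ∃ τ, 0 < τ ∧ ∃ Δ' M', 0 < Δ' ∧ 0 < M' ∧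
          EventualGain (fun x => A x + (-(α x / √(1 + ‖D x‖ ^ 2)) + τ⁻¹ * u (τ • x)) • b)
            Δ' M' := by
  obtain ⟨σ, hσ, Q, θ, hQ, hθ, hdef⟩ := exists_saturation_defect hc hN hC
  refine ⟨σ, hσ, fun D hD u η K Δ M hη hK hΔ hM hu1 hu2 hgain => ?_⟩
  have hdef := hdef D hD
  obtain ⟨V, hV⟩ : ∃ V, V = ‖α‖ + ‖β‖ := ⟨_, rfl⟩
  have hV0 : 0 ≤ V := by rw [hV]; positivity
  -- With `e = η / τ` the bound on the rescaled feedback, the conditions on `τ` ensure in turn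
  -- `2 e ≤ θ`, `Q (2 e)³ ≤ Δ / (2 τ)` and the contraction `M Q (2 e)² K ≤ 1 / 2`.
  obtain ⟨τ, hτ1, hτθ, hτΔ, hτM⟩ : ∃ τ : ℝ, 1 ≤ τ ∧ 2 * η / θ ≤ τ ∧ 16 * Q * η ^ 3 / Δ ≤ τ ∧
      8 * M * K * Q * η ^ 2 ≤ τ :=
    ⟨max (max 1 (2 * η / θ)) (max (16 * Q * η ^ 3 / Δ) (8 * M * K * Q * η ^ 2)),
      (le_max_left _ _).trans (le_max_left _ _), (le_max_right _ _).trans (le_max_left _ _),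
      (le_max_left _ _).trans (le_max_right _ _), (le_max_right _ _).trans (le_max_right _ _)⟩
  have hτ : 0 < τ := by linarith
  have hττ : τ ≤ τ ^ 2 := by nlinarith
  have hgain := hgain.scale hτ
  obtain ⟨e, he⟩ : ∃ e, e = η / τ := ⟨_, rfl⟩
  have he0 : 0 < e := by rw [he]; positivity
  have heτ : e * τ = η := by rw [he]; field_simp
  have heθ : 2 * e ≤ θ := by
    rw [div_le_iff₀ hθ] at hτθ
    rw [he, mul_div_assoc', div_le_iff₀ hτ]; linarith
  have hcubic : Q * (2 * e) ^ 3 ≤ Δ / (2 * τ) := by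
    rw [div_le_iff₀ hΔ] at hτΔ
    rw [le_div_iff₀ (by positivity)]
    have h1 : 16 * Q * η ^ 3 ≤ Δ * τ ^ 2 := by nlinarith
    have h2 : Q * (2 * e) ^ 3 * (2 * τ) * τ ^ 2 = 16 * Q * η ^ 3 := by rw [← heτ]; ring
    exact le_of_mul_le_mul_right (h2.trans_le h1) (by positivity)
  obtain ⟨q, hq⟩ : ∃ q, q = Q * (2 * e) ^ 2 := ⟨_, rfl⟩
  have hq0 : 0 ≤ q := by rw [hq]; positivity
  have hcontr : M * q * K ≤ 1 / 2 := by
    have h1 : M * q * K * (2 * τ ^ 2) = 8 * M * K * Q * η ^ 2 := by rw [hq, ← heτ]; ring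
    have h2 : M * q * K * (2 * τ ^ 2) ≤ 1 / 2 * (2 * τ ^ 2) := by rw [h1]; linarith
    exact le_of_mul_le_mul_right h2 (by positivity)
  have hv1 : ∀ x, |τ⁻¹ * u (τ • x)| ≤ e := fun x => by
    rw [abs_mul, abs_of_pos (inv_pos.2 hτ), inv_mul_eq_div, he]
    exact div_le_div_of_nonneg_right (hu1 _) hτ.le
  have hv2 : ∀ x, |τ⁻¹ * u (τ • x)| ≤ K * ‖x‖ := fun x => by
    rw [abs_mul, abs_of_pos (inv_pos.2 hτ), inv_mul_eq_div, div_le_iff₀ hτ]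
    have := hu2 (τ • x)
    rw [norm_smul, Real.norm_of_nonneg hτ.le] at this
    linarith
  obtain ⟨c, hcdef⟩ : ∃ c, c = 2 * (M * (1 + q * (V + 1))) := ⟨_, rfl⟩
  have hc0 : 0 < c := by rw [hcdef]; positivity
  refine ⟨τ, hτ, min (e / (V + 1)) (Δ / (2 * τ)), c + 1, by positivity, by positivity, ?_⟩
  intro x x' δ hδ hδΔ hx hbd
  have hδe : (V + 1) * δ ≤ e := by
    have := hδΔ.trans (min_le_left _ _)
    rwa [le_div_iff₀' (by positivity)] at this
  have hδ2 : δ ≤ Δ / (2 * τ) := hδΔ.trans (min_le_right _ _)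
  -- A bound on the rescaled feedback gives a bound on the state.
  have hround : ∀ ε, δ ≤ ε → ε ≤ 2 * e →
      (∀ᶠ t in atTop, |τ⁻¹ * u (τ • x t)| + V * δ ≤ ε) →
      ∀ᶠ t in atTop, ‖x t‖ ≤ M * (δ + Q * ε ^ 3) := by
    intro ε hδε hεe hvε
    have hε : 0 < ε := hδ.trans_le hδε
    rw [hV] at hvε
    refine hgain x x' _ (by positivity) ?_ hx
      (hdef (fun x => τ⁻¹ * u (τ • x)) x x' δ ε hδ hδε (hεe.trans heθ) hx hbd hvε)
    have h1 : Q * ε ^ 3 ≤ Q * (2 * e) ^ 3 := by gcongr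
    have h2 : Δ / τ = Δ / (2 * τ) + Δ / (2 * τ) := by field_simp; ring
    linarith
  -- The feedback is at most `K ‖x‖`, so the bound on the state improves the bound on the feedback.
  have hiter : ∀ n : ℕ, ∀ᶠ t in atTop, ‖x t‖ ≤ M * (Δ / τ) / 2 ^ n + c * δ := by
    intro n
    induction n with
    | zero =>
      filter_upwards [hround (2 * e) (by nlinarith) le_rfl
        (Eventually.of_forall fun t => by nlinarith [hv1 (x t)])] with t ht
      refine ht.trans ?_
      have h2 : Δ / τ = Δ / (2 * τ) + Δ / (2 * τ) := by field_simp; ring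
      have h3 : M * (δ + Q * (2 * e) ^ 3) ≤ M * (Δ / τ) := by gcongr; linarith
      have h4 : 0 ≤ c * δ := by positivity
      rw [pow_zero, div_one]
      linarith
    | succ n ih =>
      obtain ⟨R, hR⟩ : ∃ R, R = M * (Δ / τ) / 2 ^ n + c * δ := ⟨_, rfl⟩
      rw [← hR] at ih
      have hR0 : 0 ≤ R := by rw [hR]; positivity
      have hm : 0 ≤ min e (K * R) := by positivity
      have hε1 : δ ≤ min e (K * R) + (V + 1) * δ := by nlinarith
      have hε2 : min e (K * R) + (V + 1) * δ ≤ 2 * e := by linarith [min_le_left e (K * R)]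
      filter_upwards [hround (min e (K * R) + (V + 1) * δ) hε1 hε2 (ih.mono fun t ht => by
        have h1 : |τ⁻¹ * u (τ • x t)| ≤ min e (K * R) :=
          le_min (hv1 _) ((hv2 _).trans (by gcongr))
        linarith)] with t ht
      refine ht.trans ?_
      have h1 : Q * (min e (K * R) + (V + 1) * δ) ^ 3 ≤ q * (K * R + (V + 1) * δ) := by
        calc _ = Q * (min e (K * R) + (V + 1) * δ) ^ 2 * (min e (K * R) + (V + 1) * δ) := by ring
          _ ≤ Q * (2 * e) ^ 2 * (K * R + (V + 1) * δ) := by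
            gcongr
            exact min_le_right _ _
          _ = _ := by rw [hq]
      calc M * (δ + Q * (min e (K * R) + (V + 1) * δ) ^ 3)
          ≤ M * (δ + q * (K * R + (V + 1) * δ)) := by gcongr
        _ = M * q * K * R + c * δ / 2 := by rw [hcdef]; ring
        _ ≤ 1 / 2 * R + c * δ / 2 := by gcongr
        _ = _ := by rw [hR, pow_succ]; field_simp; ring
  obtain ⟨n, hn⟩ := ((tendsto_pow_atTop_nhds_zero_of_lt_one (r := (1 / 2 : ℝ)) (by norm_num)
    (by norm_num)).const_mul (M * (Δ / τ))).eventually_lt_const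
      (by simpa using hδ : M * (Δ / τ) * 0 < δ) |>.exists
  filter_upwards [hiter n] with t ht
  refine ht.trans ?_
  rw [one_div, inv_pow, ← div_eq_mul_inv] at hn
  linarith

end Gain

/-! ### Spectral bookkeeping -/

section Matrix

open Matrix Polynomial

variable {n : ℕ}

theorem complexify_charpoly (A : Matrix (Fin n) (Fin n) ℝ) :
    (complexify A).charpoly = A.charpoly.map Complex.ofRealHom :=
  Matrix.charpoly_map A Complex.ofRealHom

theorem mem_roots_iff_mem_spectrum {A : Matrix (Fin n) (Fin n) ℝ} {z : ℂ} :
    z ∈ (complexify A).charpoly.roots ↔ z ∈ spectrum ℂ (complexify A) := by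
  rw [Matrix.mem_spectrum_iff_isRoot_charpoly, mem_roots (Matrix.charpoly_monic _).ne_zero]

open Classical in
/-- Each critical block corresponds to one root on the closed upper half of the imaginary axis. -/
theorem numCriticalBlocks_eq_card (A : Matrix (Fin n) (Fin n) ℝ) :
    numCriticalBlocks A = Multiset.card
      ((complexify A).charpoly.roots.filter (fun z : ℂ => z.re = 0 ∧ 0 ≤ z.im)) := by
  have h0 : zeroMultiplicity A = Multiset.card
      ((complexify A).charpoly.roots.filter (fun z : ℂ => z = 0)) := by
    rw [zeroMultiplicity, eq_rootMultiplicity_map (f := Complex.ofRealHom) Complex.ofReal_injective,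
      ← complexify_charpoly, map_zero, ← count_roots, Multiset.count, Multiset.countP_eq_card_filter]
    congr 2; ext z; exact eq_comm
  rw [numCriticalBlocks, h0, numImaginaryPairs, ← Multiset.card_add,
    ← Multiset.countP_eq_card_filter, Multiset.card_add, ← Multiset.countP_eq_card_filter,
    ← Multiset.countP_eq_card_filter]
  generalize (complexify A).charpoly.roots = s
  induction s using Multiset.induction_on with
  | empty => simp
  | cons z s ih =>
    simp only [Multiset.countP_cons]
    rw [← ih]
    have hz : z = 0 ↔ z.re = 0 ∧ z.im = 0 := Complex.ext_iff
    have h : (if z.re = 0 ∧ 0 < z.im then 1 else 0) + (if z = 0 then 1 else 0) =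
        if z.re = 0 ∧ 0 ≤ z.im then 1 else 0 := by
      split_ifs <;> grind
    split_ifs at h ⊢ <;> omega

/-- Closing the loop on a critical pair replaces the factor `X² + ω²` of the characteristic
polynomial by `X² + X + ω²`. -/
theorem charpoly_sub_vecMulVec {A : Matrix (Fin n) (Fin n) ℝ} {b α β : Fin n → ℝ} {ω : ℝ}
    (h1 : α ᵥ* A = -ω • β) (h2 : β ᵥ* A = ω • α) (h3 : α ⬝ᵥ b = 1) (h4 : β ⬝ᵥ b = 0) :
    (A - vecMulVec b α).charpoly * (X ^ 2 + C (ω ^ 2)) =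
      A.charpoly * (X ^ 2 + X + C (ω ^ 2)) := by
  -- At each real `z` where `z - A` is invertible and `z² + ω² ≠ 0`, the matrix determinant lemma
  -- applies, with `α (z - A)⁻¹ b = z / (z² + ω²)`.
  refine eq_of_infinite_eval_eq _ _ (Set.Infinite.mono (s := ({z | z ∈ A.charpoly.roots} ∪
    {z : ℝ | z ^ 2 + ω ^ 2 = 0})ᶜ) ?_ ?_)
  · intro z hz
    simp only [Set.mem_compl_iff, Set.mem_union, Set.mem_ofPred_eq, not_or,
      mem_roots (charpoly_monic A).ne_zero, IsRoot.def, eval_charpoly] at hz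
    obtain ⟨hz1, hz2⟩ := hz
    set M := Matrix.scalar (Fin n) z - A with hM
    have hu : IsUnit M.det := isUnit_iff_ne_zero.2 hz1
    have hs : ∀ v : Fin n → ℝ, v ᵥ* M = z • v - v ᵥ* A := by
      intro v
      rw [hM, vecMul_sub, Matrix.scalar_apply]
      congr 1
      ext i
      simp [vecMul_diagonal, mul_comm]
    have hα : (z • α - ω • β) ᵥ* M = (z ^ 2 + ω ^ 2) • α := by
      rw [sub_vecMul, smul_vecMul, smul_vecMul, hs, hs, h1, h2]
      ext i
      simp only [Pi.sub_apply, Pi.smul_apply, smul_eq_mul]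
      ring
    have hα' : (z ^ 2 + ω ^ 2) • (α ᵥ* M⁻¹) = z • α - ω • β := by
      rw [← smul_vecMul, ← hα, vecMul_vecMul, mul_nonsing_inv _ hu, vecMul_one]
    have hval : (z ^ 2 + ω ^ 2) * (α ᵥ* M⁻¹ ⬝ᵥ b) = z := by
      rw [← smul_eq_mul, ← smul_dotProduct, hα', sub_dotProduct, smul_dotProduct, smul_dotProduct,
        h3, h4]
      simp
    have hdet : (M + vecMulVec b α).det = M.det * (1 + α ᵥ* M⁻¹ ⬝ᵥ b) := by
      rw [vecMulVec_eq Unit, det_add_replicateCol_mul_replicateRow hu,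
        det_unique (n := Unit)]
      rfl
    have hsub : Matrix.scalar (Fin n) z - (A - vecMulVec b α) = M + vecMulVec b α := by
      rw [hM]; abel
    simp only [Set.mem_ofPred_eq, eval_mul, eval_add, eval_pow, eval_X, eval_C, eval_charpoly]
    rw [hsub, hdet, ← hM, mul_assoc]
    congr 1
    linear_combination hval
  · refine Set.Finite.infinite_compl (Set.Finite.union (Multiset.finite_toSet _) ?_)
    refine Set.Finite.subset (Set.finite_singleton 0) fun z hz => ?_
    have hz : z ^ 2 + ω ^ 2 = 0 := hz
    have : z ^ 2 = 0 := by nlinarith [sq_nonneg z, sq_nonneg ω]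
    simpa using this

theorem complexify_charpoly_sub_vecMulVec {A : Matrix (Fin n) (Fin n) ℝ} {b α β : Fin n → ℝ}
    {ω : ℝ} (h1 : α ᵥ* A = -ω • β) (h2 : β ᵥ* A = ω • α) (h3 : α ⬝ᵥ b = 1) (h4 : β ⬝ᵥ b = 0) :
    (complexify (A - vecMulVec b α)).charpoly * ((X - C (ω * Complex.I)) * (X - C (-ω * Complex.I)))
      = (complexify A).charpoly * (X ^ 2 + X + C ((ω : ℂ) ^ 2)) := by
  have h := congrArg (Polynomial.map Complex.ofRealHom) (charpoly_sub_vecMulVec h1 h2 h3 h4)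
  simp only [Polynomial.map_mul, Polynomial.map_add, Polynomial.map_pow, map_X, map_C,
    ← complexify_charpoly] at h
  have h5 : (X - C ((ω : ℂ) * Complex.I)) * (X - C (-(ω : ℂ) * Complex.I)) =
      X ^ 2 + C (Complex.ofRealHom (ω ^ 2)) := by
    have : (C ((ω : ℂ) * Complex.I)) ^ 2 = - C (Complex.ofRealHom (ω ^ 2)) := by
      rw [← C_pow, mul_pow, Complex.I_sq, ← C_neg]; simp
    rw [neg_mul, C_neg]
    linear_combination -this
  rw [h5, h]
  simp

theorem quadratic_root_re {ω : ℝ} {z : ℂ} (hz : z ^ 2 + z + (ω : ℂ) ^ 2 = 0) :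
    z.re ≤ 0 ∧ (z.re = 0 → z = 0 ∧ ω = 0) := by
  have hre := congrArg Complex.re hz
  have him := congrArg Complex.im hz
  simp [sq] at hre him
  have him' : z.im * (2 * z.re + 1) = 0 := by linarith
  rcases mul_eq_zero.1 him' with h | h
  · rw [h] at hre
    refine ⟨by nlinarith [mul_self_nonneg ω, mul_self_nonneg z.re], fun h0 => ?_⟩
    rw [h0] at hre
    exact ⟨Complex.ext h0 h, by simpa using hre⟩
  · exact ⟨by linarith, fun h0 => by rw [h0] at h; norm_num at h⟩

/-- The loop closed on a critical pair has no unstable eigenvalue and one critical block less. -/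
theorem critical_step {A : Matrix (Fin n) (Fin n) ℝ} {b α β : Fin n → ℝ}
    {ω : ℝ} (hω : 0 ≤ ω) (hA : NoEigenvalueWithPosRe A)
    (h1 : α ᵥ* A = -ω • β) (h2 : β ᵥ* A = ω • α) (h3 : α ⬝ᵥ b = 1) (h4 : β ⬝ᵥ b = 0) :
    NoEigenvalueWithPosRe (A - vecMulVec b α) ∧
      numCriticalBlocks (A - vecMulVec b α) + 1 = numCriticalBlocks A := by
  classical
  have h := complexify_charpoly_sub_vecMulVec h1 h2 h3 h4
  have hmon : (X ^ 2 + X + C ((ω : ℂ) ^ 2)).Monic := by monicity!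
  have hne : (complexify A).charpoly * (X ^ 2 + X + C ((ω : ℂ) ^ 2)) ≠ 0 :=
    ((charpoly_monic _).mul hmon).ne_zero
  have hroots := congrArg Polynomial.roots h
  rw [roots_mul hne, roots_mul (h ▸ hne), roots_mul (mul_ne_zero (X_sub_C_ne_zero _)
    (X_sub_C_ne_zero _)), roots_X_sub_C, roots_X_sub_C] at hroots
  have hquad : ∀ z ∈ (X ^ 2 + X + C ((ω : ℂ) ^ 2)).roots, z ^ 2 + z + (ω : ℂ) ^ 2 = 0 := by
    intro z hz
    have := (mem_roots hmon.ne_zero).1 hz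
    simpa using this
  constructor
  · intro z hz hpos
    rw [← mem_roots_iff_mem_spectrum] at hz
    have : z ∈ (complexify A).charpoly.roots + (X ^ 2 + X + C ((ω : ℂ) ^ 2)).roots := by
      rw [← hroots]; exact Multiset.mem_add.2 (Or.inl hz)
    rcases Multiset.mem_add.1 this with h5 | h5
    · exact hA z (mem_roots_iff_mem_spectrum.1 h5) hpos
    · exact absurd hpos (quadratic_root_re (hquad z h5)).1.not_gt
  · have hcount := congrArg (Multiset.countP fun z : ℂ => z.re = 0 ∧ 0 ≤ z.im) hroots
    rw [Multiset.countP_add, Multiset.countP_add, Multiset.countP_add] at hcount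
    rw [numCriticalBlocks_eq_card, numCriticalBlocks_eq_card, ← Multiset.countP_eq_card_filter,
      ← Multiset.countP_eq_card_filter]
    have e : ∀ w : ℂ, Multiset.countP (fun z : ℂ => z.re = 0 ∧ 0 ≤ z.im) {w} =
        if w.re = 0 ∧ 0 ≤ w.im then 1 else 0 := fun w => by
      rw [← Multiset.cons_zero, Multiset.countP_cons, Multiset.countP_zero, zero_add]
    rw [e, e] at hcount
    rcases hω.eq_or_lt with h0 | h0
    · subst h0
      have hq : (X ^ 2 + X + C (((0 : ℝ) : ℂ) ^ 2)) = (X - C 0) * (X - C (-1 : ℂ)) := by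
        simp; ring
      rw [hq, roots_mul (mul_ne_zero (X_sub_C_ne_zero _) (X_sub_C_ne_zero _)), roots_X_sub_C,
        roots_X_sub_C, Multiset.countP_add, e, e] at hcount
      norm_num at hcount
      omega
    · have hq : Multiset.countP (fun z : ℂ => z.re = 0 ∧ 0 ≤ z.im)
          (X ^ 2 + X + C ((ω : ℂ) ^ 2)).roots = 0 := by
        refine Multiset.countP_eq_zero.2 fun z hz hz' => ?_
        exact h0.ne' ((quadratic_root_re (hquad z hz)).2 hz'.1).2
      rw [hq] at hcount
      simp [h0.le, h0.not_ge] at hcount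
      omega

/-- A critical eigenvalue of a stabilizable pair gives a left-invariant pair of vectors on which
the input acts (Hautus test). -/
theorem exists_critical_vectors {A : Matrix (Fin n) (Fin n) ℝ} {b : EuclideanSpace ℝ (Fin n)}
    (hAb : IsStabilizable A b) (hμ : 0 < numCriticalBlocks A) :
    ∃ (ω : ℝ) (α β : Fin n → ℝ), 0 ≤ ω ∧ α ᵥ* A = -ω • β ∧ β ᵥ* A = ω • α ∧
      α ⬝ᵥ (fun i => b i) = 1 ∧ β ⬝ᵥ (fun i => b i) = 0 ∧ (ω ≠ 0 ∨ β = 0) := by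
  classical
  rw [numCriticalBlocks_eq_card, Multiset.card_pos_iff_exists_mem] at hμ
  obtain ⟨z, hz⟩ := hμ
  obtain ⟨hz, hre, him⟩ := Multiset.mem_filter.1 hz
  obtain ⟨k, hk⟩ := hAb
  have hdet : (Matrix.scalar (Fin n) z - complexify A).det = 0 := by
    rw [← eval_charpoly]; exact (mem_roots (charpoly_monic _).ne_zero).1 hz
  obtain ⟨v, hv0, hv⟩ := exists_vecMul_eq_zero_iff.2 hdet
  have hs : ∀ (w : Fin n → ℂ), w ᵥ* Matrix.scalar (Fin n) z = z • w := by
    intro w; rw [Matrix.scalar_apply]; ext i; simp [vecMul_diagonal, mul_comm]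
  have hvA : v ᵥ* complexify A = z • v := by
    rw [vecMul_sub, hs, sub_eq_zero] at hv; exact hv.symm
  -- A left eigenvector that annihilates `b` would survive in `A - b kᵀ`.
  have hvb : v ⬝ᵥ (fun i => (b i : ℂ)) ≠ 0 := by
    intro h0
    have hzspec : z ∈ spectrum ℂ
        (complexify (A - vecMulVec (fun i => b i) (fun i => k i))) := by
      rw [Matrix.mem_spectrum_iff_isRoot_charpoly, IsRoot.def, eval_charpoly]
      refine exists_vecMul_eq_zero_iff.1 ⟨v, hv0, ?_⟩
      have : complexify (A - vecMulVec (fun i => b i) (fun i => k i)) =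
          complexify A - vecMulVec (fun i => (b i : ℂ)) (fun i => (k i : ℂ)) := by
        ext i j; simp [complexify, vecMulVec_apply]
      rw [this, vecMul_sub, vecMul_sub, hs, hvA, vecMul_vecMulVec, h0]
      simp
    exact absurd (hk z hzspec) (by rw [hre]; exact lt_irrefl _)
  obtain ⟨w, hw⟩ : ∃ w, w = (v ⬝ᵥ (fun i => (b i : ℂ)))⁻¹ • v := ⟨_, rfl⟩
  have hwA : w ᵥ* complexify A = z • w := by rw [hw, smul_vecMul, hvA, smul_comm]
  have hwb : w ⬝ᵥ (fun i => (b i : ℂ)) = 1 := by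
    rw [hw, smul_dotProduct, smul_eq_mul, inv_mul_cancel₀ hvb]
  have hz' : z = z.im * Complex.I := by apply Complex.ext <;> simp [hre]
  have hα : (fun i => (w i).re) ᵥ* A = -z.im • fun i => (w i).im := by
    ext i
    have := congrArg Complex.re (congrFun hwA i)
    simp [vecMul, dotProduct, complexify, hre] at this
    simp [vecMul, dotProduct, this]
  have hβ : (fun i => (w i).im) ᵥ* A = z.im • fun i => (w i).re := by
    ext i
    have := congrArg Complex.im (congrFun hwA i)
    simp [vecMul, dotProduct, complexify, hre] at this
    simp [vecMul, dotProduct, this]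
  have hαb : (fun i => (w i).re) ⬝ᵥ (fun i => b i) = 1 := by
    have := congrArg Complex.re hwb
    simpa [dotProduct] using this
  have hβb : (fun i => (w i).im) ⬝ᵥ (fun i => b i) = 0 := by
    have := congrArg Complex.im hwb
    simpa [dotProduct] using this
  -- For the eigenvalue `0` the real part of `w` is already a left eigenvector.
  by_cases h0 : z.im = 0
  · refine ⟨0, fun i => (w i).re, 0, le_rfl, ?_, by simp, hαb, by simp, Or.inr rfl⟩
    rw [hα, h0]; simp
  · exact ⟨z.im, _, _, him, hα, hβ, hαb, hβb, Or.inl h0⟩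

theorem isHurwitz_of_numCriticalBlocks_eq_zero {A : Matrix (Fin n) (Fin n) ℝ}
    (hA : NoEigenvalueWithPosRe A) (h : numCriticalBlocks A = 0) : IsHurwitz A := by
  classical
  rw [numCriticalBlocks_eq_card, Multiset.card_eq_zero, Multiset.filter_eq_nil] at h
  intro z hz
  rcases (not_lt.1 (hA z hz)).lt_or_eq with h1 | h1
  · exact h1
  · exfalso
    rw [← mem_roots_iff_mem_spectrum] at hz
    rcases le_total 0 z.im with h2 | h2
    · exact h z hz ⟨h1, h2⟩
    · refine h (starRingEnd ℂ z) ?_ ⟨by simpa using h1, by simpa using h2⟩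
      rw [mem_roots (charpoly_monic _).ne_zero, IsRoot.def, complexify_charpoly] at hz ⊢
      have := congrArg (starRingEnd ℂ) hz
      rw [map_zero] at this
      rw [eval_map, eval₂_eq_sum_range] at this ⊢
      simpa [map_sum] using this

theorem isStabilizable_sub {A : Matrix (Fin n) (Fin n) ℝ} {b : EuclideanSpace ℝ (Fin n)}
    (hAb : IsStabilizable A b) (α : Fin n → ℝ) :
    IsStabilizable (A - vecMulVec (fun i => b i) α) b := by
  obtain ⟨k, hk⟩ := hAb
  refine ⟨k - WithLp.toLp 2 α, ?_⟩
  convert hk using 1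
  ext i j
  simp [vecMulVec_apply]; ring

/-- A weighted sum of squares of a matrix and two functionals is again the square of a matrix. -/
theorem exists_matrix_norm_sq (σ : ℝ) (C : Matrix (Fin n) (Fin n) ℝ) (α β : Fin n → ℝ) :
    ∃ D : Matrix (Fin n) (Fin n) ℝ, ∀ x : EuclideanSpace ℝ (Fin n),
      ‖toEuclideanCLM (𝕜 := ℝ) D x‖ ^ 2 = σ ^ 2 * ‖toEuclideanCLM (𝕜 := ℝ) C x‖ ^ 2 +
        (α ⬝ᵥ x.ofLp) ^ 2 + (β ⬝ᵥ x.ofLp) ^ 2 := by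
  open scoped MatrixOrder in
  obtain ⟨S, hS⟩ : ∃ S, S = σ ^ 2 • (Cᴴ * C) + vecMulVec α (star α) + vecMulVec β (star β) :=
    ⟨_, rfl⟩
  have hpos : S.PosSemidef := by
    rw [hS]
    exact (((posSemidef_conjTranspose_mul_self C).smul (sq_nonneg σ)).add
      (posSemidef_vecMulVec_self_star α)).add (posSemidef_vecMulVec_self_star β)
  have hsa : IsSelfAdjoint (CFC.sqrt S) := (CFC.sqrt_nonneg S).isSelfAdjoint
  have hsq : CFC.sqrt S * CFC.sqrt S = S := CFC.sqrt_mul_sqrt_self S hpos.nonneg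
  have hnorm : ∀ (M : Matrix (Fin n) (Fin n) ℝ) (x : EuclideanSpace ℝ (Fin n)),
      ‖toEuclideanCLM (𝕜 := ℝ) M x‖ ^ 2 = x.ofLp ⬝ᵥ ((Mᴴ * M) *ᵥ x.ofLp) := by
    intro M x
    rw [EuclideanSpace.real_norm_sq_eq, ← mulVec_mulVec, dotProduct_mulVec,
      conjTranspose_eq_transpose_of_trivial, vecMul_transpose]
    simp [dotProduct, sq]
  refine ⟨CFC.sqrt S, fun x => ?_⟩
  have h1 : (CFC.sqrt S)ᴴ = CFC.sqrt S := hsa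
  rw [hnorm, hnorm, h1, hsq, hS]
  simp only [add_mulVec, dotProduct_add, smul_mulVec, dotProduct_smul, smul_eq_mul, star_trivial,
    vecMulVec_mulVec]
  simp [dotProduct_comm x.ofLp, sq]

/-! ### Hurwitz matrices -/

/-- The isometric inclusion of real vectors into complex vectors. -/
noncomputable def ofRealVec (n : ℕ) : EuclideanSpace ℝ (Fin n) →L[ℝ] EuclideanSpace ℂ (Fin n) :=
  LinearMap.toContinuousLinearMap
    { toFun := fun x => WithLp.toLp 2 fun i => (x i : ℂ)
      map_add' := fun x y => by ext i; simp
      map_smul' := fun c x => by ext i; simp }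

theorem ofRealVec_apply (x : EuclideanSpace ℝ (Fin n)) (i : Fin n) : ofRealVec n x i = x i := rfl

theorem norm_ofRealVec (x : EuclideanSpace ℝ (Fin n)) : ‖ofRealVec n x‖ = ‖x‖ := by
  simp [EuclideanSpace.norm_eq, ofRealVec_apply]

theorem ofRealVec_toEuclideanCLM (M : Matrix (Fin n) (Fin n) ℝ) (x : EuclideanSpace ℝ (Fin n)) :
    ofRealVec n (toEuclideanCLM (𝕜 := ℝ) M x) =
      toEuclideanCLM (𝕜 := ℂ) (complexify M) (ofRealVec n x) := by
  ext i
  simp [ofRealVec_apply, complexify, mulVec, dotProduct]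

/-- The Cayley–Hamilton theorem with the characteristic polynomial split into linear factors. -/
theorem prod_sub_roots_charpoly (B : Matrix (Fin n) (Fin n) ℂ) :
    (B.charpoly.roots.toList.map fun z => toEuclideanCLM (𝕜 := ℂ) B -
      z • (1 : EuclideanSpace ℂ (Fin n) →L[ℂ] EuclideanSpace ℂ (Fin n))).prod = 0 := by
  have h1 : B.charpoly = (B.charpoly.roots.toList.map fun z => X - C z).prod := by
    conv_lhs => rw [(IsAlgClosed.splits B.charpoly).eq_prod_roots_of_monic (charpoly_monic B)]
    conv_lhs => rw [← Multiset.coe_toList B.charpoly.roots]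
    rw [Multiset.map_coe, Multiset.prod_coe]
  have h2 := congrArg (fun p => toEuclideanCLM (𝕜 := ℂ) (aeval B p)) h1
  simp only [aeval_self_charpoly, map_zero, map_list_prod, List.map_map] at h2
  rw [h2]
  congr 1
  refine List.map_congr_left fun z _ => ?_
  simp [Algebra.algebraMap_eq_smul_one]

theorem IsHurwitz.exists_gain {M : Matrix (Fin n) (Fin n) ℝ} (hM : IsHurwitz M) :
    ∃ N, 0 < N ∧ ∀ Δ, EventualGain (toEuclideanCLM (𝕜 := ℝ) M) Δ N := by
  obtain ⟨N, hN, h⟩ := exists_gain_of_prod (toEuclideanCLM (𝕜 := ℂ) (complexify M))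
    (complexify M).charpoly.roots.toList
    (fun z hz => hM z (mem_roots_iff_mem_spectrum.1 (Multiset.mem_toList.1 hz)))
  refine ⟨N, hN, fun Δ x x' δ hδ _ hx hbd => ?_⟩
  have := h (fun t => ofRealVec n (x t)) (fun t => ofRealVec n (x' t)) δ hδ
    (hx.mono fun t ht => (ofRealVec n).hasFDerivAt.comp_hasDerivAt t ht) ?_
    (Eventually.of_forall fun t => by rw [prod_sub_roots_charpoly]; simpa using hδ.le)
  · simpa only [norm_ofRealVec] using this
  · simpa only [← ofRealVec_toEuclideanCLM, ← map_sub, norm_ofRealVec] using hbd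

theorem IsHurwitz.exists_bound {M : Matrix (Fin n) (Fin n) ℝ} (hM : IsHurwitz M) :
    ∃ N, 0 < N ∧ ∀ (x x' : ℝ → EuclideanSpace ℝ (Fin n)) (δ T : ℝ), 0 ≤ δ → ‖x 0‖ ≤ δ →
      ContinuousOn x (Set.Icc 0 T) →
      (∀ t ∈ Set.Ico 0 T, HasDerivWithinAt x (x' t) (Set.Ici t) t) →
      (∀ t ∈ Set.Ico 0 T, ‖x' t - toEuclideanCLM (𝕜 := ℝ) M (x t)‖ ≤ δ) →
      ∀ t ∈ Set.Icc 0 T, ‖x t‖ ≤ N * δ := by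
  obtain ⟨N, hN, h⟩ := exists_bound_of_prod (toEuclideanCLM (𝕜 := ℂ) (complexify M))
    (complexify M).charpoly.roots.toList
    (fun z hz => hM z (mem_roots_iff_mem_spectrum.1 (Multiset.mem_toList.1 hz)))
  refine ⟨N, hN, fun x x' δ T hδ h0 hcont hx hbd => ?_⟩
  have := h (fun t => ofRealVec n (x t)) (fun t => ofRealVec n (x' t)) δ T hδ
    (by rwa [norm_ofRealVec]) ((ofRealVec n).continuous.comp_continuousOn hcont)
    (fun t ht => (ofRealVec n).hasFDerivAt.comp_hasDerivWithinAt t (hx t ht)) ?_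
    (fun t _ => by rw [prod_sub_roots_charpoly]; simpa using hδ)
  · simpa only [norm_ofRealVec] using this
  · simpa only [← ofRealVec_toEuclideanCLM, ← map_sub, norm_ofRealVec] using hbd

end Matrix

/-! ### Construction of the feedback -/

section Design

open Matrix

variable {n m : ℕ}

local notation "𝓔" => EuclideanSpace ℝ (Fin n)

theorem closedLoop_linearSystem (A : Matrix (Fin n) (Fin n) ℝ) (b : 𝓔) (ν : 𝓔 → ℝ) :
    closedLoop (linearSystem A b) ν = fun x => toEuclideanCLM (𝕜 := ℝ) A x + ν x • b := rfl

theorem closedLoop_linearSystem_apply (A : Matrix (Fin n) (Fin n) ℝ) (b : 𝓔) (ν : 𝓔 → ℝ) (x : 𝓔) :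
    closedLoop (linearSystem A b) ν x = toEuclideanCLM (𝕜 := ℝ) A x + ν x • b := rfl

theorem satFeedback_apply (k : Fin m → 𝓔) (T : Fin m → Matrix (Fin n) (Fin n) ℝ) (x : 𝓔) :
    satFeedback k T x =
      - ∑ j, inner ℝ (k j) x / √(1 + ‖toEuclideanCLM (𝕜 := ℝ) (T j) x‖ ^ 2) := rfl

theorem norm_smul_toEuclideanCLM {τ : ℝ} (hτ : 0 < τ) (M : Matrix (Fin n) (Fin n) ℝ) (x : 𝓔) :
    ‖toEuclideanCLM (𝕜 := ℝ) (τ • M) x‖ = τ * ‖toEuclideanCLM (𝕜 := ℝ) M x‖ := by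
  rw [map_smul, _root_.smul_apply, norm_smul, Real.norm_of_nonneg hτ.le]

theorem satFeedback_smul {τ : ℝ} (hτ : 0 < τ) (k : Fin m → 𝓔)
    (T : Fin m → Matrix (Fin n) (Fin n) ℝ) (x : 𝓔) :
    satFeedback k (fun j => τ • T j) x = τ⁻¹ * satFeedback k T (τ • x) := by
  rw [satFeedback_apply, satFeedback_apply, mul_neg, Finset.mul_sum]
  congr 1
  refine Finset.sum_congr rfl fun j _ => ?_
  rw [map_smul, map_smul, inner_smul_right, _root_.smul_apply, mul_div_assoc,
    ← mul_assoc, inv_mul_cancel₀ hτ.ne', one_mul]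

theorem satFeedback_cons (k₀ : 𝓔) (T₀ : Matrix (Fin n) (Fin n) ℝ) (k : Fin m → 𝓔)
    (T : Fin m → Matrix (Fin n) (Fin n) ℝ) (x : 𝓔) :
    satFeedback (Fin.cons k₀ k : Fin (m + 1) → 𝓔) (Fin.cons T₀ T) x =
      -(inner ℝ k₀ x / √(1 + ‖toEuclideanCLM (𝕜 := ℝ) T₀ x‖ ^ 2)) + satFeedback k T x := by
  rw [satFeedback_apply, satFeedback_apply, Fin.sum_univ_succ, neg_add]
  rfl

/-- The properties of a family `(k_j, T_j)` that give all the claims about its feedback. The first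
one says that `T_j x` evolves autonomously up to the input and determines `k_jᵀ x`. -/
structure IsGoodDesign (A : Matrix (Fin n) (Fin n) ℝ) (b : 𝓔) (k : Fin m → 𝓔)
    (T : Fin m → Matrix (Fin n) (Fin n) ℝ) : Prop where
  factor : ∃ K, 0 < K ∧ ∀ j x,
    ‖toEuclideanCLM (𝕜 := ℝ) (T j) (toEuclideanCLM (𝕜 := ℝ) A x)‖ ≤
      K * ‖toEuclideanCLM (𝕜 := ℝ) (T j) x‖ ∧
    |inner ℝ (k j) x| ≤ K * ‖toEuclideanCLM (𝕜 := ℝ) (T j) x‖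
  hurwitz : IsHurwitz (A - vecMulVec (fun i => b i) (∑ j, (k j).ofLp))
  gain : ∃ Δ N, 0 < Δ ∧ 0 < N ∧
    EventualGain (closedLoop (linearSystem A b) (satFeedback k T)) Δ N

theorem toEuclideanCLM_sub_vecMulVec (A : Matrix (Fin n) (Fin n) ℝ) (b : 𝓔) (α : Fin n → ℝ) :
    toEuclideanCLM (𝕜 := ℝ) (A - vecMulVec (fun i => b i) α) =
      toEuclideanCLM (𝕜 := ℝ) A - (innerSL ℝ (WithLp.toLp 2 α : 𝓔)).smulRight b := by
  ext x i
  simp [vecMulVec_mulVec, PiLp.inner_apply, dotProduct, mul_comm]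

theorem innerSL_toLp_apply (α : Fin n → ℝ) (x : 𝓔) :
    innerSL ℝ (WithLp.toLp 2 α : 𝓔) x = α ⬝ᵥ x.ofLp := by
  simp [PiLp.inner_apply, dotProduct, mul_comm]

theorem criticalPair_of_vectors {A : Matrix (Fin n) (Fin n) ℝ} {b : 𝓔} {ω : ℝ} {α β : Fin n → ℝ}
    (h1 : α ᵥ* A = -ω • β) (h2 : β ᵥ* A = ω • α) (h3 : α ⬝ᵥ (fun i => b i) = 1)
    (h4 : β ⬝ᵥ (fun i => b i) = 0) (h5 : ω ≠ 0 ∨ β = 0) :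
    CriticalPair (toEuclideanCLM (𝕜 := ℝ) A) b ω (innerSL ℝ (WithLp.toLp 2 α : 𝓔))
      (innerSL ℝ (WithLp.toLp 2 β : 𝓔)) where
  apply_left x := by
    rw [innerSL_toLp_apply, innerSL_toLp_apply, ofLp_toEuclideanCLM, dotProduct_mulVec, h1,
      smul_dotProduct, smul_eq_mul]
  apply_right x := by
    rw [innerSL_toLp_apply, innerSL_toLp_apply, ofLp_toEuclideanCLM, dotProduct_mulVec, h2,
      smul_dotProduct, smul_eq_mul]
  left_input := by rw [innerSL_toLp_apply]; exact h3
  right_input := by rw [innerSL_toLp_apply]; exact h4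
  ne_zero_or := h5.imp id fun h => by rw [h]; ext x; simp

theorem abs_satFeedback_le {k : Fin m → 𝓔} {T : Fin m → Matrix (Fin n) (Fin n) ℝ} {K : ℝ}
    (hK : 0 < K) (h : ∀ j x, |inner ℝ (k j) x| ≤ K * ‖toEuclideanCLM (𝕜 := ℝ) (T j) x‖) (x : 𝓔) :
    |satFeedback k T x| ≤ m * K := by
  rw [satFeedback_apply, abs_neg]
  refine (Finset.abs_sum_le_sum_abs _ _).trans ?_
  have : ∀ j ∈ Finset.univ, |inner ℝ (k j) x / √(1 + ‖toEuclideanCLM (𝕜 := ℝ) (T j) x‖ ^ 2)| ≤ K := by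
    intro j _
    rw [abs_div, abs_of_nonneg (Real.sqrt_nonneg _), div_le_iff₀ (by positivity)]
    refine (h j x).trans ?_
    gcongr
    exact Real.le_sqrt_of_sq_le (by linarith)
  simpa using Finset.sum_le_sum this

theorem abs_satFeedback_le_mul_norm (k : Fin m → 𝓔) (T : Fin m → Matrix (Fin n) (Fin n) ℝ)
    (x : 𝓔) : |satFeedback k T x| ≤ (∑ j, ‖k j‖) * ‖x‖ := by
  rw [satFeedback_apply, abs_neg, Finset.sum_mul]
  refine (Finset.abs_sum_le_sum_abs _ _).trans (Finset.sum_le_sum fun j _ => ?_)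
  rw [abs_div, abs_of_nonneg (Real.sqrt_nonneg _)]
  refine (div_le_self (abs_nonneg _) (Real.one_le_sqrt.2 ?_)).trans (abs_real_inner_le_norm _ _)
  linarith [sq_nonneg ‖toEuclideanCLM (𝕜 := ℝ) (T j) x‖]

/-- A stabilized block is put in front of a design for the remaining ones. -/
theorem IsGoodDesign.cons {A D : Matrix (Fin n) (Fin n) ℝ} {b : 𝓔} {α : Fin n → ℝ}
    {k : Fin m → 𝓔} {T : Fin m → Matrix (Fin n) (Fin n) ℝ}
    (h : IsGoodDesign (A - vecMulVec (fun i => b i) α) b k T) {K₀ K₁ τ : ℝ} (hK₀ : 0 < K₀)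
    (hDA : ∀ x, ‖toEuclideanCLM (𝕜 := ℝ) D (toEuclideanCLM (𝕜 := ℝ) A x)‖ ≤
      K₀ * ‖toEuclideanCLM (𝕜 := ℝ) D x‖)
    (hDα : ∀ x, |innerSL ℝ (WithLp.toLp 2 α : 𝓔) x| ≤ ‖toEuclideanCLM (𝕜 := ℝ) D x‖)
    (hK₁ : 0 < K₁) (hDT : ∀ j x, ‖toEuclideanCLM (𝕜 := ℝ) D x‖ ≤
      K₁ * ‖toEuclideanCLM (𝕜 := ℝ) (T j) x‖) (hτ : 0 < τ)
    (hgain : ∃ Δ N, 0 < Δ ∧ 0 < N ∧ EventualGain (fun x => toEuclideanCLM (𝕜 := ℝ) A x +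
      (-(innerSL ℝ (WithLp.toLp 2 α : 𝓔) x / √(1 + ‖toEuclideanCLM (𝕜 := ℝ) D x‖ ^ 2)) +
        τ⁻¹ * satFeedback k T (τ • x)) • b) Δ N) :
    IsGoodDesign A b (Fin.cons (WithLp.toLp 2 α) k : Fin (m + 1) → 𝓔)
      (Fin.cons D fun j => τ • T j) where
  factor := by
    obtain ⟨K₂, hK₂, hfac⟩ := h.factor
    have hsum : 0 ≤ ∑ j, ‖toEuclideanCLM (𝕜 := ℝ) (T j) b‖ * K₁ := by positivity
    have hdiv : 0 ≤ K₂ / τ := by positivity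
    refine ⟨K₀ + 1 + K₂ + K₂ / τ + ∑ j, ‖toEuclideanCLM (𝕜 := ℝ) (T j) b‖ * K₁,
      by positivity, ?_⟩
    refine Fin.cases (fun x => ?_) fun j x => ?_
    · have h0 := norm_nonneg (toEuclideanCLM (𝕜 := ℝ) D x)
      refine ⟨(hDA x).trans (mul_le_mul_of_nonneg_right ?_ h0), (hDα x).trans ?_⟩
      · linarith
      · exact le_mul_of_one_le_left h0 (by linarith)
    · simp only [Fin.cons_succ, norm_smul_toEuclideanCLM hτ]
      obtain ⟨e1, e2⟩ := hfac j x
      have h0 := norm_nonneg (toEuclideanCLM (𝕜 := ℝ) (T j) x)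
      constructor
      · have e4 : toEuclideanCLM (𝕜 := ℝ) A x =
            toEuclideanCLM (𝕜 := ℝ) (A - vecMulVec (fun i => b i) α) x +
              innerSL ℝ (WithLp.toLp 2 α : 𝓔) x • b := by
          rw [toEuclideanCLM_sub_vecMulVec]; simp
        have e3 : ‖toEuclideanCLM (𝕜 := ℝ) (T j) (toEuclideanCLM (𝕜 := ℝ) A x)‖ ≤
            (K₂ + ‖toEuclideanCLM (𝕜 := ℝ) (T j) b‖ * K₁) *
              ‖toEuclideanCLM (𝕜 := ℝ) (T j) x‖ := by
          rw [e4, map_add, map_smul, add_mul]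
          refine (norm_add_le _ _).trans (add_le_add e1 ?_)
          rw [norm_smul, Real.norm_eq_abs, mul_comm, mul_assoc]
          exact mul_le_mul_of_nonneg_left ((hDα x).trans (hDT j x)) (norm_nonneg _)
        have e5 : ‖toEuclideanCLM (𝕜 := ℝ) (T j) b‖ * K₁ ≤
            ∑ j, ‖toEuclideanCLM (𝕜 := ℝ) (T j) b‖ * K₁ :=
          Finset.single_le_sum (f := fun j => ‖toEuclideanCLM (𝕜 := ℝ) (T j) b‖ * K₁)
            (fun j _ => by positivity) (Finset.mem_univ j)
        rw [mul_left_comm]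
        refine mul_le_mul_of_nonneg_left (e3.trans ?_) hτ.le
        refine mul_le_mul_of_nonneg_right ?_ h0
        linarith
      · refine e2.trans ?_
        rw [← mul_assoc]
        refine mul_le_mul_of_nonneg_right ?_ h0
        rw [← div_le_iff₀ hτ]
        linarith
  hurwitz := by
    convert h.hurwitz using 1
    rw [Fin.sum_univ_succ]
    ext i j
    simp [vecMulVec_apply]
    ring
  gain := by
    obtain ⟨Δ, N, hΔ, hN, hgain⟩ := hgain
    refine ⟨Δ, N, hΔ, hN, ?_⟩
    convert hgain using 1
    ext1 x
    rw [closedLoop_linearSystem]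
    simp only [satFeedback_cons, satFeedback_smul hτ]
    rfl

/-- Induction on the number of critical blocks. The matrix `C` records the blocks that have
already been stabilized; every `T_j` has to see them, because the linear feedback that stabilized
them is not bounded. -/
theorem exists_design_of_stableOutput (b : 𝓔) (m : ℕ) :
    ∀ A C : Matrix (Fin n) (Fin n) ℝ, NoEigenvalueWithPosRe A → IsStabilizable A b →
      numCriticalBlocks A = m →
      (∃ N, 0 < N ∧ StableOutput (toEuclideanCLM (𝕜 := ℝ) A) (toEuclideanCLM (𝕜 := ℝ) C) N) →
      (∃ K, 0 < K ∧ ∀ x, ‖toEuclideanCLM (𝕜 := ℝ) C (toEuclideanCLM (𝕜 := ℝ) A x)‖ ≤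
        K * ‖toEuclideanCLM (𝕜 := ℝ) C x‖) →
      ∃ (k : Fin m → 𝓔) (T : Fin m → Matrix (Fin n) (Fin n) ℝ), IsGoodDesign A b k T ∧
        ∃ K, 0 < K ∧ ∀ j x, ‖toEuclideanCLM (𝕜 := ℝ) C x‖ ≤
          K * ‖toEuclideanCLM (𝕜 := ℝ) (T j) x‖ := by
  induction m with
  | zero =>
    intro A C hA hAb hμ _ _
    have hH := isHurwitz_of_numCriticalBlocks_eq_zero hA hμ
    obtain ⟨N, hN, hgain⟩ := hH.exists_gain
    refine ⟨Fin.elim0, Fin.elim0, ⟨⟨1, one_pos, fun j => j.elim0⟩, ?_, 1, N, one_pos, hN, ?_⟩,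
      1, one_pos, fun j => j.elim0⟩
    · convert hH using 1
      ext i j
      simp
    · convert hgain 1 using 1
      ext1 x
      simp [closedLoop_linearSystem, satFeedback]
  | succ m ih =>
    rintro A C hA hAb hμ ⟨N, hN, hC⟩ ⟨K, hK, hCA⟩
    obtain ⟨ω, α, β, hω, h1, h2, h3, h4, h5⟩ := exists_critical_vectors hAb (hμ ▸ m.succ_pos)
    have hc := criticalPair_of_vectors h1 h2 h3 h4 h5
    obtain ⟨hA', hμ'⟩ := critical_step hω hA h1 h2 h3 h4
    obtain ⟨σ, hσ, hblock⟩ := exists_gain_step hc hN hC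
    obtain ⟨D, hD⟩ := exists_matrix_norm_sq σ C α β
    simp only [← innerSL_toLp_apply] at hD
    have hDC := mul_norm_le_norm_output hσ hD
    have hDα := abs_left_le_norm_output hD
    obtain ⟨K₀, hK₀, hDA⟩ := hc.exists_norm_output_le hω hσ hD hK hCA
    have hDA' := exists_norm_output_sub_le (b := b) hDα hK₀ hDA
    have hstable := StableOutput.extend hc hN hC hσ hD
    have hstep := hblock _ hD
    rw [← toEuclideanCLM_sub_vecMulVec] at hstable hDA' hstep
    obtain ⟨k, T, hgood, K₁, hK₁, hDT⟩ := ih _ D hA' (isStabilizable_sub hAb α)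
      (by omega) hstable hDA'
    obtain ⟨K₂, hK₂, hfac⟩ := hgood.factor
    obtain ⟨Δ, M, hΔ, hM, hgain⟩ := hgood.gain
    obtain ⟨τ, hτ, hgain'⟩ := hstep (satFeedback k T) (m * K₂ + 1)
      ((∑ j, ‖k j‖) + 1) Δ M (by positivity) (by positivity) hΔ hM
      (fun x => (abs_satFeedback_le hK₂ (fun j x => (hfac j x).2) x).trans (by linarith))
      (fun x => (abs_satFeedback_le_mul_norm k T x).trans (by
        have := norm_nonneg x; linarith)) hgain
    refine ⟨_, _, hgood.cons hK₀ hDA hDα hK₁ hDT hτ hgain', 1 / σ + K₁ / (σ * τ),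
      by positivity, ?_⟩
    refine Fin.cases (fun x => ?_) fun j x => ?_
    · rw [Fin.cons_zero]
      have e1 := hDC x
      rw [← le_div_iff₀' hσ] at e1
      have e2 : 0 ≤ K₁ / (σ * τ) * ‖toEuclideanCLM (𝕜 := ℝ) D x‖ := by positivity
      calc _ ≤ _ := e1
        _ = 1 / σ * ‖toEuclideanCLM (𝕜 := ℝ) D x‖ := by ring
        _ ≤ _ := by rw [add_mul]; linarith
    · rw [Fin.cons_succ, norm_smul_toEuclideanCLM hτ]
      have e1 := (hDC x).trans (hDT j x)
      rw [← le_div_iff₀' hσ] at e1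
      have e2 : 0 ≤ 1 / σ * (τ * ‖toEuclideanCLM (𝕜 := ℝ) (T j) x‖) := by positivity
      calc _ ≤ _ := e1
        _ = K₁ / (σ * τ) * (τ * ‖toEuclideanCLM (𝕜 := ℝ) (T j) x‖) := by field_simp
        _ ≤ _ := by rw [add_mul]; linarith

/-- The induction is started with `C = 0`: no block has been removed yet. -/
theorem exists_isGoodDesign {A : Matrix (Fin n) (Fin n) ℝ} {b : 𝓔}
    (hA : NoEigenvalueWithPosRe A) (hAb : IsStabilizable A b) :
    ∃ (k : Fin (numCriticalBlocks A) → 𝓔)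
      (T : Fin (numCriticalBlocks A) → Matrix (Fin n) (Fin n) ℝ), IsGoodDesign A b k T := by
  obtain ⟨k, T, h, -⟩ := exists_design_of_stableOutput b (numCriticalBlocks A) A 0 hA hAb rfl
    ⟨1, one_pos, fun x x' δ hδ _ _ => Eventually.of_forall fun t => by simpa using hδ.le⟩
    ⟨1, one_pos, fun x => by simp⟩
  exact ⟨k, T, h⟩

theorem IsGoodDesign.smul {A : Matrix (Fin n) (Fin n) ℝ} {b : 𝓔} {k : Fin m → 𝓔}
    {T : Fin m → Matrix (Fin n) (Fin n) ℝ} (h : IsGoodDesign A b k T) {τ : ℝ} (hτ : 0 < τ) :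
    IsGoodDesign A b k (fun j => τ • T j) where
  factor := by
    obtain ⟨K, hK, hfac⟩ := h.factor
    refine ⟨K + K / τ, by positivity, fun j x => ?_⟩
    simp only [norm_smul_toEuclideanCLM hτ]
    have e0 := norm_nonneg (toEuclideanCLM (𝕜 := ℝ) (T j) x)
    constructor
    · rw [mul_left_comm]
      refine mul_le_mul_of_nonneg_left ((hfac j x).1.trans ?_) hτ.le
      refine mul_le_mul_of_nonneg_right ?_ e0
      have : 0 < K / τ := by positivity
      linarith
    · refine (hfac j x).2.trans ?_
      rw [← mul_assoc]
      refine mul_le_mul_of_nonneg_right ?_ e0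
      rw [← div_le_iff₀ hτ]
      linarith
  hurwitz := h.hurwitz
  gain := by
    obtain ⟨Δ, N, hΔ, hN, hgain⟩ := h.gain
    refine ⟨Δ / τ, N, by positivity, hN, ?_⟩
    rw [closedLoop_linearSystem] at hgain ⊢
    simpa only [satFeedback_smul hτ] using hgain.scale hτ

end Design

/-! ### Global solutions of Lipschitz integral equations -/

section Existence

open scoped NNReal

variable {E : Type*} [NormedAddCommGroup E] [NormedSpace ℝ E]

theorem integral_exp_mul_le {lam t : ℝ} (hlam : 0 < lam) :
    Real.exp (-(lam * t)) * ∫ s in (0 : ℝ)..t, Real.exp (lam * s) ≤ 1 / lam := by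
  have h1 : ∫ s in (0 : ℝ)..t, Real.exp (lam * s) = (Real.exp (lam * t) - 1) / lam := by
    rw [intervalIntegral.integral_comp_mul_left (fun s => Real.exp s) hlam.ne', integral_exp]
    simp [div_eq_inv_mul]
  rw [h1, mul_div_assoc', mul_sub, ← Real.exp_add, neg_add_cancel, Real.exp_zero, mul_one]
  gcongr
  linarith [Real.exp_pos (-(lam * t))]

/-- Global existence for `x = x₀ + ∫ F(x) + g`, by contraction in the space of continuous curves
`t ↦ e^{λ t} w(t)` with `w` bounded. -/
theorem exists_integral_solution [CompleteSpace E] {F : E → E} {K : ℝ≥0} (hF : LipschitzWith K F)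
    {g : ℝ → E} (hg : Continuous g) {M : ℝ} (hgM : ∀ t, 0 ≤ t → ‖g t‖ ≤ M * t) (x₀ : E) :
    ∃ x : ℝ → E, Continuous x ∧ ∀ t, 0 ≤ t → x t = x₀ + (∫ s in (0 : ℝ)..t, F (x s)) + g t := by
  obtain ⟨lam, hlam⟩ : ∃ lam : ℝ, lam = 2 * (K + 1) := ⟨_, rfl⟩
  have hK : (0 : ℝ) ≤ K := K.2
  have hlam0 : 0 < lam := by rw [hlam]; positivity
  have hM : 0 ≤ M := by simpa using (norm_nonneg _).trans (hgM 1 zero_le_one)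
  obtain ⟨p, hp⟩ : ∃ p : ℝ → ℝ, p = fun t => max t 0 := ⟨_, rfl⟩
  have hp0 : ∀ t, 0 ≤ p t := fun t => by rw [hp]; exact le_max_right _ _
  have hpc : Continuous p := by rw [hp]; fun_prop
  have hcont : ∀ w : BoundedContinuousFunction ℝ E,
      Continuous fun s => F (Real.exp (lam * s) • w s) := fun w =>
    hF.continuous.comp ((by fun_prop : Continuous fun s : ℝ => Real.exp (lam * s)).smul w.continuous)
  have hcexp : Continuous fun s : ℝ => Real.exp (lam * s) := by fun_prop
  let Ψ : BoundedContinuousFunction ℝ E → ℝ → E := fun w t =>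
    Real.exp (-(lam * p t)) • (x₀ + (∫ s in (0 : ℝ)..p t, F (Real.exp (lam * s) • w s)) + g (p t))
  have hΨc : ∀ w, Continuous (Ψ w) := by
    intro w
    have h1 : Continuous fun t => ∫ s in (0 : ℝ)..t, F (Real.exp (lam * s) • w s) :=
      intervalIntegral.continuous_primitive (fun a b => (hcont w).intervalIntegrable a b) 0
    exact (by fun_prop : Continuous fun t : ℝ => Real.exp (-(lam * p t))).smul
      ((continuous_const.add (h1.comp hpc)).add (hg.comp hpc))
  have hpe : ∀ t, Real.exp (-(lam * p t)) * p t ≤ 1 / lam := by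
    intro t
    rw [le_div_iff₀ hlam0, Real.exp_neg, mul_assoc, inv_mul_le_iff₀ (Real.exp_pos _)]
    linarith [Real.add_one_le_exp (lam * p t)]
  have hΨb : ∀ w t, ‖Ψ w t‖ ≤ ‖x₀‖ + (‖F 0‖ + M) * (1 / lam) + K * ‖w‖ * (1 / lam) := by
    intro w t
    have h1 : ‖∫ s in (0 : ℝ)..p t, F (Real.exp (lam * s) • w s)‖ ≤
        ∫ s in (0 : ℝ)..p t, (‖F 0‖ + K * ‖w‖ * Real.exp (lam * s)) := by
      refine intervalIntegral.norm_integral_le_of_norm_le (hp0 t) (Eventually.of_forall fun s _ => ?_)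
        ((by fun_prop : Continuous fun s : ℝ =>
          ‖F 0‖ + K * ‖w‖ * Real.exp (lam * s)).intervalIntegrable _ _)
      have h2 := hF.norm_sub_le (Real.exp (lam * s) • w s) 0
      rw [sub_zero, norm_smul, Real.norm_of_nonneg (Real.exp_pos _).le] at h2
      have h3 : ↑K * (Real.exp (lam * s) * ‖w s‖) ≤ K * ‖w‖ * Real.exp (lam * s) := by
        rw [mul_assoc, mul_comm ‖w‖]
        gcongr
        exact w.norm_coe_le_norm s
      have h4 := norm_le_norm_add_norm_sub (F 0) (F (Real.exp (lam * s) • w s))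
      rw [norm_sub_rev] at h4
      linarith
    rw [intervalIntegral.integral_add intervalIntegrable_const
      ((hcexp.const_mul _).intervalIntegrable _ _),
      intervalIntegral.integral_const, intervalIntegral.integral_const_mul, sub_zero,
      smul_eq_mul] at h1
    rw [norm_smul, Real.norm_of_nonneg (Real.exp_pos _).le]
    have h5 : ‖x₀ + (∫ s in (0 : ℝ)..p t, F (Real.exp (lam * s) • w s)) + g (p t)‖ ≤
        ‖x₀‖ + (p t * ‖F 0‖ + K * ‖w‖ * ∫ s in (0 : ℝ)..p t, Real.exp (lam * s)) + M * p t :=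
      (norm_add_le _ _).trans (add_le_add ((norm_add_le _ _).trans (by gcongr)) (hgM _ (hp0 t)))
    have h6 : Real.exp (-(lam * p t)) ≤ 1 := by
      rw [Real.exp_le_one_iff]; have := hp0 t; nlinarith
    calc _ ≤ Real.exp (-(lam * p t)) * (‖x₀‖ + (p t * ‖F 0‖ +
            K * ‖w‖ * ∫ s in (0 : ℝ)..p t, Real.exp (lam * s)) + M * p t) := by gcongr
      _ = Real.exp (-(lam * p t)) * ‖x₀‖ + (‖F 0‖ + M) * (Real.exp (-(lam * p t)) * p t) +
          K * ‖w‖ * (Real.exp (-(lam * p t)) * ∫ s in (0 : ℝ)..p t, Real.exp (lam * s)) := by ring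
      _ ≤ _ := by
        refine add_le_add (add_le_add ?_ ?_) ?_
        · exact mul_le_of_le_one_left (norm_nonneg _) h6
        · exact mul_le_mul_of_nonneg_left (hpe t) (by positivity)
        · exact mul_le_mul_of_nonneg_left (integral_exp_mul_le hlam0) (by positivity)
  let Φ : BoundedContinuousFunction ℝ E → BoundedContinuousFunction ℝ E := fun w =>
    BoundedContinuousFunction.ofNormedAddCommGroup (Ψ w) (hΨc w) _ (hΨb w)
  have hΦ : ContractingWith (1 / 2) Φ := by
    refine ⟨by rw [← NNReal.coe_lt_coe]; norm_num, LipschitzWith.of_dist_le_mul fun w v => ?_⟩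
    rw [BoundedContinuousFunction.dist_le (by positivity)]
    intro t
    have h1 : ‖(∫ s in (0 : ℝ)..p t, F (Real.exp (lam * s) • w s)) -
        ∫ s in (0 : ℝ)..p t, F (Real.exp (lam * s) • v s)‖ ≤
        ∫ s in (0 : ℝ)..p t, K * dist w v * Real.exp (lam * s) := by
      rw [← intervalIntegral.integral_sub ((hcont w).intervalIntegrable _ _)
        ((hcont v).intervalIntegrable _ _)]
      refine intervalIntegral.norm_integral_le_of_norm_le (hp0 t) (Eventually.of_forall fun s _ => ?_)
        ((by fun_prop : Continuous fun s : ℝ =>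
          K * dist w v * Real.exp (lam * s)).intervalIntegrable _ _)
      refine (hF.norm_sub_le _ _).trans ?_
      rw [← smul_sub, norm_smul, Real.norm_of_nonneg (Real.exp_pos _).le, mul_assoc,
        mul_comm (dist w v), ← dist_eq_norm]
      gcongr
      exact BoundedContinuousFunction.dist_coe_le_dist s
    rw [intervalIntegral.integral_const_mul] at h1
    have h2 : Φ w t - Φ v t = Real.exp (-(lam * p t)) •
        ((∫ s in (0 : ℝ)..p t, F (Real.exp (lam * s) • w s)) -
        ∫ s in (0 : ℝ)..p t, F (Real.exp (lam * s) • v s)) := by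
      change Ψ w t - Ψ v t = _
      simp only [Ψ]
      rw [← smul_sub]
      congr 1
      abel
    rw [dist_eq_norm, h2, norm_smul, Real.norm_of_nonneg (Real.exp_pos _).le]
    have hKl : K * (1 / lam) ≤ 1 / 2 := by
      rw [mul_one_div, div_le_iff₀ hlam0, hlam]; linarith
    calc _ ≤ Real.exp (-(lam * p t)) *
          (K * dist w v * ∫ s in (0 : ℝ)..p t, Real.exp (lam * s)) := by gcongr
      _ = K * dist w v * (Real.exp (-(lam * p t)) * ∫ s in (0 : ℝ)..p t, Real.exp (lam * s)) := by
        ring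
      _ ≤ K * dist w v * (1 / lam) :=
        mul_le_mul_of_nonneg_left (integral_exp_mul_le hlam0) (by positivity)
      _ = K * (1 / lam) * dist w v := by ring
      _ ≤ 1 / 2 * dist w v := by gcongr
      _ = _ := by simp
  have hfix : Φ (hΦ.fixedPoint Φ) = hΦ.fixedPoint Φ := hΦ.fixedPoint_isFixedPt
  obtain ⟨w, hw⟩ : ∃ w, w = hΦ.fixedPoint Φ := ⟨_, rfl⟩
  rw [← hw] at hfix
  refine ⟨fun t => Real.exp (lam * t) • w t, hcexp.smul w.continuous, fun t ht => ?_⟩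
  have h1 : w t = Ψ w t := by
    conv_lhs => rw [← hfix]
    rfl
  have hpt : p t = t := by rw [hp]; exact max_eq_left ht
  change Real.exp (lam * t) • w t = _
  rw [h1]
  simp only [Ψ]
  rw [hpt, smul_smul, ← Real.exp_add, add_neg_cancel, Real.exp_zero, one_smul]

theorem exists_isTrajectory [CompleteSpace E] {F : E → E} {K : ℝ≥0} (hF : LipschitzWith K F)
    (x₀ : E) : ∃ x : ℝ → E, IsTrajectory F x ∧ x 0 = x₀ := by
  obtain ⟨x, hxc, hx⟩ := exists_integral_solution hF (g := fun _ => (0 : E)) continuous_const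
    (M := 0) (by simp) x₀
  refine ⟨x, fun t ht => ?_, by simpa using hx 0 le_rfl⟩
  have h1 : HasDerivAt (fun t => x₀ + ∫ s in (0 : ℝ)..t, F (x s)) (F (x t)) t :=
    ((hF.continuous.comp hxc).integral_hasStrictDerivAt 0 t).hasDerivAt.const_add x₀
  exact h1.hasDerivWithinAt.congr (fun s hs => by simpa using hx s hs) (by simpa using hx t ht)

end Existence

/-! ### From differentiable curves to Carathéodory solutions -/

section Caratheodory

open scoped NNReal

theorem intervalIntegrable_indicator {E : Type*} [NormedAddCommGroup E] [MeasurableSpace E]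
    [BorelSpace E] [SecondCountableTopology E] {e : ℝ → E} {M : ℝ}
    (he : AEMeasurable e (volume.restrict (Set.Ici (0 : ℝ)))) (hM : ∀ t, 0 ≤ t → ‖e t‖ ≤ M)
    (a b : ℝ) : IntervalIntegrable ((Set.Ici (0 : ℝ)).indicator e) volume a b := by
  have h1 : AEStronglyMeasurable ((Set.Ici (0 : ℝ)).indicator e) volume :=
    (aestronglyMeasurable_indicator_iff measurableSet_Ici).2 he.aestronglyMeasurable
  refine (intervalIntegrable_const (c := |M|)).mono_fun h1.restrict
    (Eventually.of_forall fun t => ?_)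
  change ‖(Set.Ici (0 : ℝ)).indicator e t‖ ≤ ‖|M|‖
  by_cases ht : t ∈ Set.Ici (0 : ℝ)
  · rw [Set.indicator_of_mem ht, Real.norm_eq_abs, abs_abs]
    exact (hM t ht).trans (le_abs_self M)
  · rw [Set.indicator_of_notMem ht]; simp

theorem integral_indicator_Ici {E : Type*} [NormedAddCommGroup E] [NormedSpace ℝ E] {f : ℝ → E}
    {t : ℝ} (ht : 0 ≤ t) :
    ∫ s in (0 : ℝ)..t, (Set.Ici (0 : ℝ)).indicator f s = ∫ s in (0 : ℝ)..t, f s := by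
  refine intervalIntegral.integral_congr fun s hs => ?_
  rw [Set.uIcc_of_le ht] at hs
  exact Set.indicator_of_mem (s := Set.Ici (0 : ℝ)) hs.1 f

variable {E : Type*} [NormedAddCommGroup E] [NormedSpace ℝ E] [MeasurableSpace E] [BorelSpace E]
  [SecondCountableTopology E]

theorem exists_isCaratheodorySolution [CompleteSpace E] {F : E → E} {K : ℝ≥0}
    (hF : LipschitzWith K F) {e : ℝ → E} {M : ℝ}
    (he : AEMeasurable e (volume.restrict (Set.Ici (0 : ℝ)))) (hM : ∀ t, 0 ≤ t → ‖e t‖ ≤ M)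
    (x₀ : E) : ∃ x : ℝ → E, IsCaratheodorySolution (fun x u => F x + u) e x ∧ x 0 = x₀ := by
  have hint := intervalIntegrable_indicator he hM
  obtain ⟨x, hxc, hx⟩ := exists_integral_solution hF
    (g := fun t => ∫ s in (0 : ℝ)..t, (Set.Ici (0 : ℝ)).indicator e s)
    (intervalIntegral.continuous_primitive hint 0) (M := M) (fun t ht => by
      rw [integral_indicator_Ici ht]
      refine (intervalIntegral.norm_integral_le_of_norm_le_const fun s hs => ?_).trans_eq
        (by rw [sub_zero, abs_of_nonneg ht])
      rw [Set.uIoc_of_le ht] at hs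
      exact hM s hs.1.le) x₀
  have hx0 : x 0 = x₀ := by simpa using hx 0 le_rfl
  refine ⟨x, ⟨hxc.continuousOn, fun t ht => ?_⟩, hx0⟩
  have h1 : IntervalIntegrable (fun s => F (x s)) volume 0 t :=
    (hF.continuous.comp hxc).intervalIntegrable _ _
  have h2 : IntervalIntegrable e volume 0 t := by
    refine (hint 0 t).congr fun s hs => ?_
    rw [Set.uIoc_of_le ht] at hs
    exact Set.indicator_of_mem (s := Set.Ici (0 : ℝ)) hs.1.le e
  refine ⟨h1.add h2, ?_⟩
  rw [intervalIntegral.integral_add h1 h2, hx0, hx t ht, integral_indicator_Ici ht, add_assoc]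

/-- A merely measurable perturbation `e` is absorbed by subtracting from `x` the difference `w`
between a primitive of `e` and its average over a window of unit length: `w` is as small as `e`,
and `x - w` is differentiable. -/
theorem EventualGain.of_isCaratheodorySolution {F : E → E} {K : ℝ≥0} {Δ N δ M : ℝ}
    [CompleteSpace E]
    (hF : LipschitzWith K F) (hgain : EventualGain F Δ N) {e x : ℝ → E} (hδ : 0 < δ)
    (hδΔ : (K + 1) * δ ≤ Δ)
    (he : AEMeasurable e (volume.restrict (Set.Ici (0 : ℝ)))) (hM : ∀ t, 0 ≤ t → ‖e t‖ ≤ M)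
    (heδ : EventuallyBoundedBy e δ) (hx : IsCaratheodorySolution (fun x u => F x + u) e x) :
    EventuallyBoundedBy x ((N * (K + 1) + 1) * δ) := by
  obtain ⟨t₀, ht₀, hbd⟩ := heδ
  have hK : (0 : ℝ) ≤ K := K.2
  have hint := intervalIntegrable_indicator he hM
  set ē := (Set.Ici (0 : ℝ)).indicator e with hē
  set I : ℝ → E := fun t => ∫ s in (0 : ℝ)..t, ē s with hI
  have hIc : Continuous I := intervalIntegral.continuous_primitive hint 0
  set J : ℝ → E := fun t => ∫ s in (0 : ℝ)..t, I s with hJ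
  have hJd : ∀ t, HasDerivAt J (I t) t := fun t =>
    (hIc.integral_hasStrictDerivAt 0 t).hasDerivAt
  set y : ℝ → E := fun t => x (max t 0) with hy
  have hyc : Continuous y :=
    hx.1.comp_continuous (by fun_prop) fun t => le_max_right t 0
  have hyx : ∀ t, 0 ≤ t → y t = x t := fun t ht => by simp only [hy]; rw [max_eq_left ht]
  have hFy : Continuous fun t => F (y t) := hF.continuous.comp hyc
  set z : ℝ → E := fun t => x 0 + (∫ s in (0 : ℝ)..t, F (y s)) + (J t - J (t - 1)) with hz
  have hzd : ∀ t, HasDerivAt z (F (y t) + (I t - I (t - 1))) t := fun t => by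
    have h1 := (hFy.integral_hasStrictDerivAt 0 t).hasDerivAt.const_add (x 0)
    have h2 : HasDerivAt (fun t => J (t - 1)) (I (t - 1)) t := by
      simpa using (hJd (t - 1)).comp_sub_const t 1
    exact h1.add ((hJd t).sub h2)
  have hIdiff : ∀ s t, t₀ ≤ s → s ≤ t → ‖I t - I s‖ ≤ δ * (t - s) := by
    intro s t hs hst
    have h1 : I t - I s = ∫ r in s..t, ē r :=
      intervalIntegral.integral_interval_sub_left (hint 0 t) (hint 0 s)
    rw [h1, ← abs_of_nonneg (sub_nonneg.2 hst)]
    refine intervalIntegral.norm_integral_le_of_norm_le_const fun r hr => ?_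
    rw [Set.uIoc_of_le hst] at hr
    have hr' : t₀ ≤ r := hs.trans hr.1.le
    rw [hē, Set.indicator_of_mem (s := Set.Ici (0 : ℝ)) (ht₀.le.trans hr')]
    exact hbd r hr'
  have hw : ∀ t, t₀ + 1 ≤ t → ‖I t - (J t - J (t - 1))‖ ≤ δ := by
    intro t ht
    have h1 : J t - J (t - 1) = ∫ s in (t - 1)..t, I s :=
      intervalIntegral.integral_interval_sub_left (hIc.intervalIntegrable _ _)
        (hIc.intervalIntegrable _ _)
    have h2 : I t - (J t - J (t - 1)) = ∫ s in (t - 1)..t, (I t - I s) := by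
      rw [intervalIntegral.integral_sub (by simp) (hIc.intervalIntegrable _ _), h1]
      simp
    rw [h2]
    have h3 := intervalIntegral.norm_integral_le_of_norm_le_const (a := t - 1) (b := t) (C := δ)
      (f := fun s => I t - I s) fun s hs => by
        rw [Set.uIoc_of_le (by linarith)] at hs
        refine (hIdiff s t (by linarith [hs.1]) hs.2).trans ?_
        have := hs.1
        nlinarith
    simpa using h3
  have hxz : ∀ t, t₀ + 1 ≤ t → x t - z t = I t - (J t - J (t - 1)) := by
    intro t ht
    have ht0 : 0 ≤ t := by linarith
    have h1 : IntervalIntegrable (fun s => F (y s)) volume 0 t := hFy.intervalIntegrable _ _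
    have h2 : x t = x 0 + ((∫ s in (0 : ℝ)..t, F (y s)) + I t) := by
      rw [(hx.2 t ht0).2, hI]
      simp only
      rw [← intervalIntegral.integral_add h1 (hint 0 t)]
      congr 1
      refine intervalIntegral.integral_congr fun s hs => ?_
      rw [Set.uIcc_of_le ht0] at hs
      rw [hyx s hs.1, hē, Set.indicator_of_mem (s := Set.Ici (0 : ℝ)) hs.1]
    rw [h2, hz]
    simp only
    abel
  have key := hgain z _ ((K + 1) * δ) (by positivity) hδΔ (Eventually.of_forall hzd) (by
    filter_upwards [eventually_ge_atTop (t₀ + 1)] with t ht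
    have h1 : F (y t) + (I t - I (t - 1)) - F (z t) = (F (x t) - F (z t)) + (I t - I (t - 1)) := by
      rw [hyx t (by linarith)]; abel
    rw [h1]
    have h2 : ‖F (x t) - F (z t)‖ ≤ K * δ := by
      refine (hF.norm_sub_le _ _).trans ?_
      rw [hxz t ht]
      gcongr
      exact hw t ht
    have h3 := hIdiff (t - 1) t (by linarith) (by linarith)
    refine (norm_add_le _ _).trans ?_
    linarith)
  obtain ⟨t₁, ht₁⟩ := eventually_atTop.1 key
  refine ⟨max t₁ (t₀ + 1), by positivity, fun t ht => ?_⟩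
  have h1 := ht₁ t ((le_max_left _ _).trans ht)
  have h2 := hw t ((le_max_right _ _).trans ht)
  rw [← hxz t ((le_max_right _ _).trans ht)] at h2
  have h3 := norm_le_norm_add_norm_sub (z t) (x t)
  rw [norm_sub_rev] at h3
  linarith

theorem EventualGain.isInputFreeSISSL [CompleteSpace E] {F : E → E} {K : ℝ≥0}
    (hF : LipschitzWith K F) {Δ N : ℝ} (hΔ : 0 < Δ) (hN : 0 < N) (hgain : EventualGain F Δ N) :
    IsInputFreeSISSL F := by
  have hK : (0 : ℝ) ≤ K := K.2
  refine ⟨Δ / (K + 1), N * (K + 1) + 1, by positivity, by positivity, ?_⟩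
  rintro δ hδ hδΔ e he ⟨M, hM⟩ heδ
  rw [le_div_iff₀' (by positivity)] at hδΔ
  exact ⟨exists_isCaratheodorySolution hF he hM,
    fun x hx => hgain.of_isCaratheodorySolution hF hδ hδΔ he hM heδ hx⟩

end Caratheodory

/-! ### Lyapunov stability and convergence -/

section Stability

open Matrix
open scoped NNReal

variable {n m : ℕ}

local notation "𝓔" => EuclideanSpace ℝ (Fin n)

theorem abs_sqrt_one_add_sq_sub_le (s t : ℝ) : |√(1 + s ^ 2) - √(1 + t ^ 2)| ≤ |s - t| := by
  have hs : 0 < √(1 + s ^ 2) := by positivity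
  have ht : 0 < √(1 + t ^ 2) := by positivity
  have hs2 : √(1 + s ^ 2) ^ 2 = 1 + s ^ 2 := Real.sq_sqrt (by positivity)
  have ht2 : √(1 + t ^ 2) ^ 2 = 1 + t ^ 2 := Real.sq_sqrt (by positivity)
  have h1 : (√(1 + s ^ 2) - √(1 + t ^ 2)) * (√(1 + s ^ 2) + √(1 + t ^ 2)) =
      (s - t) * (s + t) := by linear_combination hs2 - ht2
  have h2 : |s + t| ≤ √(1 + s ^ 2) + √(1 + t ^ 2) :=
    (abs_add_le _ _).trans (add_le_add (Real.abs_le_sqrt (by linarith))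
      (Real.abs_le_sqrt (by linarith)))
  have h3 := congrArg abs h1
  rw [abs_mul, abs_mul, abs_of_pos (add_pos hs ht)] at h3
  refine le_of_mul_le_mul_right (h3.le.trans ?_) (add_pos hs ht)
  exact mul_le_mul_of_nonneg_left h2 (abs_nonneg _)

/-- A saturated term is globally Lipschitz when `T x` controls `kᵀ x`. -/
theorem abs_sat_sub_sat_le {X : Type*} [NormedAddCommGroup X] [NormedSpace ℝ X]
    (f : X →L[ℝ] ℝ) (T : X →L[ℝ] X) {K : ℝ} (hK : 0 ≤ K) (h : ∀ x, |f x| ≤ K * ‖T x‖) (x y : X) :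
    |f x / √(1 + ‖T x‖ ^ 2) - f y / √(1 + ‖T y‖ ^ 2)| ≤ (‖f‖ + K * ‖T‖) * ‖x - y‖ := by
  have hx : 0 < √(1 + ‖T x‖ ^ 2) := by positivity
  have hy : 0 < √(1 + ‖T y‖ ^ 2) := by positivity
  have hx1 : 1 ≤ √(1 + ‖T x‖ ^ 2) := Real.one_le_sqrt.2 (by linarith [sq_nonneg ‖T x‖])
  have hyT : ‖T y‖ ≤ √(1 + ‖T y‖ ^ 2) := Real.le_sqrt_of_sq_le (by linarith)
  have e : f x / √(1 + ‖T x‖ ^ 2) - f y / √(1 + ‖T y‖ ^ 2) =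
      f (x - y) / √(1 + ‖T x‖ ^ 2) + f y / √(1 + ‖T y‖ ^ 2) *
        ((√(1 + ‖T y‖ ^ 2) - √(1 + ‖T x‖ ^ 2)) / √(1 + ‖T x‖ ^ 2)) := by
    rw [map_sub]; field_simp; ring
  have h1 : |f (x - y) / √(1 + ‖T x‖ ^ 2)| ≤ ‖f‖ * ‖x - y‖ := by
    rw [abs_div, abs_of_pos hx]
    exact (div_le_self (abs_nonneg _) hx1).trans (f.le_opNorm _)
  have h2 : |f y / √(1 + ‖T y‖ ^ 2)| ≤ K := by
    rw [abs_div, abs_of_pos hy, div_le_iff₀ hy]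
    exact (h y).trans (mul_le_mul_of_nonneg_left hyT hK)
  have h3 : |(√(1 + ‖T y‖ ^ 2) - √(1 + ‖T x‖ ^ 2)) / √(1 + ‖T x‖ ^ 2)| ≤ ‖T‖ * ‖x - y‖ := by
    rw [abs_div, abs_of_pos hx]
    refine (div_le_self (abs_nonneg _) hx1).trans ((abs_sqrt_one_add_sq_sub_le _ _).trans ?_)
    refine (abs_norm_sub_norm_le _ _).trans ?_
    rw [← map_sub, norm_sub_rev x y]
    exact T.le_opNorm _
  rw [e, add_mul, mul_assoc]
  refine (abs_add_le _ _).trans (add_le_add h1 ?_)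
  rw [abs_mul]
  exact mul_le_mul h2 h3 (abs_nonneg _) hK

theorem IsGoodDesign.exists_lipschitzWith {A : Matrix (Fin n) (Fin n) ℝ} {b : 𝓔}
    {k : Fin m → 𝓔} {T : Fin m → Matrix (Fin n) (Fin n) ℝ} (h : IsGoodDesign A b k T) :
    ∃ K : ℝ≥0, LipschitzWith K (closedLoop (linearSystem A b) (satFeedback k T)) := by
  obtain ⟨K, hK, hfac⟩ := h.factor
  obtain ⟨L, hL⟩ : ∃ L, L = ∑ j, (‖innerSL ℝ (k j)‖ + K * ‖toEuclideanCLM (𝕜 := ℝ) (T j)‖) :=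
    ⟨_, rfl⟩
  have hν : ∀ x y, |satFeedback k T x - satFeedback k T y| ≤ L * ‖x - y‖ := by
    intro x y
    have e : satFeedback k T x - satFeedback k T y = -∑ j,
        (innerSL ℝ (k j) x / √(1 + ‖toEuclideanCLM (𝕜 := ℝ) (T j) x‖ ^ 2) -
          innerSL ℝ (k j) y / √(1 + ‖toEuclideanCLM (𝕜 := ℝ) (T j) y‖ ^ 2)) := by
      rw [Finset.sum_sub_distrib, satFeedback_apply, satFeedback_apply]
      simp only [innerSL_apply_apply]
      ring
    rw [e, abs_neg, hL, Finset.sum_mul]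
    exact (Finset.abs_sum_le_sum_abs _ _).trans (Finset.sum_le_sum fun j _ =>
      abs_sat_sub_sat_le _ _ hK.le (fun x => (hfac j x).2) x y)
  have hL0 : 0 ≤ L := by rw [hL]; positivity
  refine ⟨⟨‖toEuclideanCLM (𝕜 := ℝ) A‖ + L * ‖b‖, by positivity⟩,
    LipschitzWith.of_dist_le_mul fun x y => ?_⟩
  rw [dist_eq_norm, dist_eq_norm, closedLoop_linearSystem_apply, closedLoop_linearSystem_apply]
  have e : toEuclideanCLM (𝕜 := ℝ) A x + satFeedback k T x • b -
      (toEuclideanCLM (𝕜 := ℝ) A y + satFeedback k T y • b) =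
      toEuclideanCLM (𝕜 := ℝ) A (x - y) + (satFeedback k T x - satFeedback k T y) • b := by
    rw [map_sub, sub_smul]; abel
  change ‖toEuclideanCLM (𝕜 := ℝ) A x + satFeedback k T x • b -
    (toEuclideanCLM (𝕜 := ℝ) A y + satFeedback k T y • b)‖ ≤
    (‖toEuclideanCLM (𝕜 := ℝ) A‖ + L * ‖b‖) * ‖x - y‖
  rw [e]
  refine (norm_add_le _ _).trans ?_
  rw [norm_smul, Real.norm_eq_abs, add_mul]
  refine add_le_add (ContinuousLinearMap.le_opNorm _ _) ?_
  rw [mul_right_comm]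
  exact mul_le_mul_of_nonneg_right (hν x y) (norm_nonneg _)

/-- The closed loop agrees with its linearization at the origin up to cubic terms. -/
theorem exists_linearization_error (A : Matrix (Fin n) (Fin n) ℝ) (b : 𝓔) (k : Fin m → 𝓔)
    (T : Fin m → Matrix (Fin n) (Fin n) ℝ) : ∃ c, 0 < c ∧ ∀ x,
      ‖closedLoop (linearSystem A b) (satFeedback k T) x -
        toEuclideanCLM (𝕜 := ℝ) (A - vecMulVec (fun i => b i) (∑ j, (k j).ofLp)) x‖ ≤
      c * ‖x‖ ^ 3 := by
  obtain ⟨L, hL⟩ : ∃ L, L = ∑ j, ‖k j‖ * ‖toEuclideanCLM (𝕜 := ℝ) (T j)‖ ^ 2 := ⟨_, rfl⟩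
  have hL0 : 0 ≤ L := by rw [hL]; positivity
  refine ⟨L * ‖b‖ + 1, by positivity, fun x => ?_⟩
  have hsum : innerSL ℝ (WithLp.toLp 2 (∑ j, (k j).ofLp) : 𝓔) x = ∑ j, inner ℝ (k j) x := by
    rw [← sum_inner, innerSL_apply_apply]
    congr 1
    ext i
    simp
  have e : closedLoop (linearSystem A b) (satFeedback k T) x -
      toEuclideanCLM (𝕜 := ℝ) (A - vecMulVec (fun i => b i) (∑ j, (k j).ofLp)) x =
      (∑ j, inner ℝ (k j) x *
        (1 - 1 / √(1 + ‖toEuclideanCLM (𝕜 := ℝ) (T j) x‖ ^ 2))) • b := by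
    rw [closedLoop_linearSystem_apply, toEuclideanCLM_sub_vecMulVec, _root_.sub_apply,
      ContinuousLinearMap.smulRight_apply, hsum, satFeedback_apply]
    simp only [mul_sub, mul_one, Finset.sum_sub_distrib, sub_smul, mul_one_div, neg_smul]
    abel
  have h1 : |∑ j, inner ℝ (k j) x *
      (1 - 1 / √(1 + ‖toEuclideanCLM (𝕜 := ℝ) (T j) x‖ ^ 2))| ≤ L * ‖x‖ ^ 3 := by
    rw [hL, Finset.sum_mul]
    refine (Finset.abs_sum_le_sum_abs _ _).trans (Finset.sum_le_sum fun j _ => ?_)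
    obtain ⟨h2, h3⟩ := one_sub_inv_sqrt_le _ (sq_nonneg ‖toEuclideanCLM (𝕜 := ℝ) (T j) x‖)
    rw [abs_mul, abs_of_nonneg h2]
    have h4 : ‖toEuclideanCLM (𝕜 := ℝ) (T j) x‖ ^ 2 ≤
        (‖toEuclideanCLM (𝕜 := ℝ) (T j)‖ * ‖x‖) ^ 2 :=
      pow_le_pow_left₀ (norm_nonneg _) (ContinuousLinearMap.le_opNorm _ _) 2
    calc _ ≤ (‖k j‖ * ‖x‖) * (‖toEuclideanCLM (𝕜 := ℝ) (T j)‖ * ‖x‖) ^ 2 :=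
          mul_le_mul (abs_real_inner_le_norm _ _) (h3.trans h4) h2 (by positivity)
      _ = _ := by ring
  rw [e, norm_smul, Real.norm_eq_abs]
  have h5 := mul_le_mul_of_nonneg_right h1 (norm_nonneg b)
  have h6 : 0 ≤ ‖x‖ ^ 3 := by positivity
  linarith

/-- Stability in the first approximation: as long as a trajectory stays in a small ball, the cubic
error keeps it in the ball of half that radius. -/
theorem IsGoodDesign.lyapunov_stable {A : Matrix (Fin n) (Fin n) ℝ} {b : 𝓔}
    {k : Fin m → 𝓔} {T : Fin m → Matrix (Fin n) (Fin n) ℝ} (h : IsGoodDesign A b k T)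
    (ε : ℝ) (hε : 0 < ε) :
    ∃ δ : ℝ, 0 < δ ∧ ∀ x : ℝ → 𝓔,
      IsTrajectory (closedLoop (linearSystem A b) (satFeedback k T)) x → ‖x 0‖ < δ →
        ∀ t : ℝ, 0 ≤ t → ‖x t‖ < ε := by
  obtain ⟨N, hN, hbound⟩ := h.hurwitz.exists_bound
  obtain ⟨c, hc, herr⟩ := exists_linearization_error A b k T
  obtain ⟨r, hr, hrε, hr1, hrc⟩ : ∃ r, 0 < r ∧ r ≤ ε ∧ r ≤ 1 ∧ r ≤ 1 / (2 * N * c) :=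
    ⟨min ε (min 1 (1 / (2 * N * c))), by positivity, min_le_left _ _,
      (min_le_right _ _).trans (min_le_left _ _), (min_le_right _ _).trans (min_le_right _ _)⟩
  have hcr : c * r ^ 3 ≤ r / (2 * N) := by
    rw [le_div_iff₀ (by positivity)] at hrc ⊢
    have h1 : r ^ 3 ≤ r * r := by nlinarith [mul_pos hr hr]
    have h2 := mul_le_mul_of_nonneg_left h1 (by positivity : 0 ≤ c * (2 * N))
    nlinarith
  refine ⟨min r (r / (2 * N)), by positivity, fun x hx h0 t₁ ht₁ => ?_⟩
  by_contra hcon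
  have hxc : ContinuousOn x (Set.Ici 0) := fun t ht => (hx t ht).continuousWithinAt
  -- `τ` is the first time at which the trajectory reaches the sphere of radius `r`
  have hclosed : IsClosed (Set.Icc 0 t₁ ∩ (fun t => ‖x t‖) ⁻¹' Set.Ici r) :=
    (hxc.norm.mono Set.Icc_subset_Ici_self).preimage_isClosed_of_isClosed isClosed_Icc isClosed_Ici
  obtain ⟨τ, ⟨hτ, hτr⟩, hτmin⟩ := (isCompact_Icc.of_isClosed_subset hclosed
    Set.inter_subset_left).exists_isMinOn (f := fun t : ℝ => t)
      ⟨t₁, ⟨ht₁, le_rfl⟩, hrε.trans (not_lt.1 hcon)⟩ continuousOn_id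
  have hbefore : ∀ t ∈ Set.Ico 0 τ, ‖x t‖ < r := by
    intro t ht
    by_contra hge
    have := hτmin (show t ∈ Set.Icc 0 t₁ ∩ (fun t => ‖x t‖) ⁻¹' Set.Ici r from
      ⟨⟨ht.1, ht.2.le.trans hτ.2⟩, not_lt.1 hge⟩)
    exact absurd ht.2 (not_lt.2 this)
  have := hbound x _ (r / (2 * N)) τ (by positivity) (h0.le.trans (min_le_right _ _))
    (hxc.mono Set.Icc_subset_Ici_self)
    (fun t ht => (hx t ht.1).mono (Set.Ici_subset_Ici.2 ht.1))
    (fun t ht => (herr (x t)).trans (le_trans ?_ hcr)) τ ⟨hτ.1, le_rfl⟩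
  · have h1 : r ≤ ‖x τ‖ := hτr
    have h2 : N * (r / (2 * N)) = r / 2 := by field_simp
    linarith
  · exact mul_le_mul_of_nonneg_left
      (pow_le_pow_left₀ (norm_nonneg _) (hbefore t ht).le 3) hc.le

theorem EventualGain.tendsto_zero {X : Type*} [NormedAddCommGroup X] [NormedSpace ℝ X] {F : X → X}
    {Δ N : ℝ} (hΔ : 0 < Δ) (hN : 0 < N) (hgain : EventualGain F Δ N) {x : ℝ → X}
    (hx : IsTrajectory F x) : Tendsto x atTop (𝓝 0) := by
  rw [Metric.tendsto_nhds]
  intro ε hε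
  have hδ : 0 < min Δ (ε / (2 * N)) := by positivity
  filter_upwards [hgain x (fun t => F (x t)) _ hδ (min_le_left _ _)
    ((eventually_gt_atTop 0).mono fun t ht => (hx t ht.le).hasDerivAt (Ici_mem_nhds ht))
    (Eventually.of_forall fun t => by simpa using hδ.le)] with t ht
  rw [dist_zero_right]
  have h1 : N * min Δ (ε / (2 * N)) ≤ N * (ε / (2 * N)) := by gcongr; exact min_le_right _ _
  have h2 : N * (ε / (2 * N)) = ε / 2 := by field_simp
  linarith

theorem IsGoodDesign.isSISSLStabilizingFeedback {A : Matrix (Fin n) (Fin n) ℝ} {b : 𝓔}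
    {k : Fin m → 𝓔} {T : Fin m → Matrix (Fin n) (Fin n) ℝ} (h : IsGoodDesign A b k T) :
    IsSISSLStabilizingFeedback (linearSystem A b) (satFeedback k T) := by
  obtain ⟨K, hK⟩ := h.exists_lipschitzWith
  obtain ⟨Δ, N, hΔ, hN, hgain⟩ := h.gain
  exact ⟨⟨exists_isTrajectory hK, h.lyapunov_stable, fun x hx => hgain.tendsto_zero hΔ hN hx⟩,
    hgain.isInputFreeSISSL hK hΔ hN⟩

end Stability

/-! ### Bounds on the derivatives of the control signal -/

section Flow

open scoped ContDiff

variable {Y : Type*} [NormedAddCommGroup Y] [NormedSpace ℝ Y]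

/-- The derivative of an observable along the vector field `G`. -/
noncomputable def lieDerivative (G : Y → Y) (Φ : Y → ℝ) : Y → ℝ := fun y => fderiv ℝ Φ y (G y)

theorem contDiff_lieDerivative {G : Y → Y} (hG : ContDiff ℝ ∞ G) {Φ : Y → ℝ}
    (hΦ : ContDiff ℝ ∞ Φ) : ContDiff ℝ ∞ (lieDerivative G Φ) :=
  (hΦ.fderiv_right (m := ∞) (by simp)).clm_apply hG

theorem contDiff_iterate_lieDerivative {G : Y → Y} (hG : ContDiff ℝ ∞ G) (i : ℕ) {Φ : Y → ℝ}
    (hΦ : ContDiff ℝ ∞ Φ) : ContDiff ℝ ∞ ((lieDerivative G)^[i] Φ) := by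
  induction i with
  | zero => exact hΦ
  | succ i ih => rw [Function.iterate_succ_apply']; exact contDiff_lieDerivative hG ih

theorem hasDerivWithinAt_comp_trajectory {G : Y → Y} {Φ : Y → ℝ} (hΦ : ContDiff ℝ ∞ Φ)
    {q : ℝ → Y} (hq : IsTrajectory G q) {t : ℝ} (ht : 0 ≤ t) :
    HasDerivWithinAt (fun t => Φ (q t)) (lieDerivative G Φ (q t)) (Set.Ici 0) t :=
  (hΦ.differentiable (by simp) (q t)).hasFDerivAt.comp_hasDerivWithinAt t (hq t ht)

theorem iteratedDerivWithin_comp_trajectory {G : Y → Y} (hG : ContDiff ℝ ∞ G) {q : ℝ → Y}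
    (hq : IsTrajectory G q) (i : ℕ) : ∀ {Φ : Y → ℝ}, ContDiff ℝ ∞ Φ →
      Set.EqOn (iteratedDerivWithin i (fun t => Φ (q t)) (Set.Ici 0))
        (fun t => (lieDerivative G)^[i] Φ (q t)) (Set.Ici 0) := by
  induction i with
  | zero => intro Φ _ t _; simp
  | succ i ih =>
    intro Φ hΦ t ht
    rw [iteratedDerivWithin_succ', Function.iterate_succ_apply,
      ← ih (contDiff_lieDerivative hG hΦ) ht]
    refine iteratedDerivWithin_congr (fun s hs => ?_) ht
    exact (hasDerivWithinAt_comp_trajectory hΦ hq hs).derivWithin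
      (uniqueDiffOn_Ici (0 : ℝ) s hs)

theorem contDiffOn_comp_trajectory {G : Y → Y} (hG : ContDiff ℝ ∞ G) {q : ℝ → Y}
    (hq : IsTrajectory G q) {Φ : Y → ℝ} (hΦ : ContDiff ℝ ∞ Φ) (p : ℕ) :
    ContDiffOn ℝ p (fun t => Φ (q t)) (Set.Ici 0) := by
  refine contDiffOn_of_differentiableOn_deriv (n := p) fun i _ t ht => ?_
  exact (hasDerivWithinAt_comp_trajectory (contDiff_iterate_lieDerivative hG i hΦ) hq
    ht).differentiableWithinAt.congr (iteratedDerivWithin_comp_trajectory hG hq i hΦ)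
      (iteratedDerivWithin_comp_trajectory hG hq i hΦ ht)

/-- Along trajectories of a smooth autonomous system that stay in the unit ball of a
finite-dimensional space, the derivatives of a smooth observable are bounded uniformly. -/
theorem exists_bound_iteratedDerivWithin [FiniteDimensional ℝ Y] {G : Y → Y}
    (hG : ContDiff ℝ ∞ G) {Φ : Y → ℝ} (hΦ : ContDiff ℝ ∞ Φ) (p : ℕ) :
    ∃ M, 0 ≤ M ∧ ∀ q : ℝ → Y, IsTrajectory G q → (∀ t, 0 ≤ t → ‖q t‖ ≤ 1) →
      ∀ i ≤ p, ∀ t, 0 ≤ t → ‖iteratedDerivWithin i (fun t => Φ (q t)) (Set.Ici 0) t‖ ≤ M := by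
  have h1 : ∀ i, ∃ M, 0 ≤ M ∧ ∀ y ∈ Metric.closedBall (0 : Y) 1,
      ‖(lieDerivative G)^[i] Φ y‖ ≤ M := by
    intro i
    obtain ⟨M, hM⟩ := (isCompact_closedBall (0 : Y) 1).exists_bound_of_continuousOn
      (contDiff_iterate_lieDerivative hG i hΦ).continuous.continuousOn
    exact ⟨max M 0, le_max_right _ _, fun y hy => (hM y hy).trans (le_max_left _ _)⟩
  choose M hM0 hM using h1
  refine ⟨∑ i ∈ Finset.range (p + 1), M i, Finset.sum_nonneg fun i _ => hM0 i, ?_⟩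
  intro q hq hq1 i hi t ht
  rw [iteratedDerivWithin_comp_trajectory hG hq i hΦ ht]
  refine (hM i _ (by simpa using hq1 t ht)).trans ?_
  exact Finset.single_le_sum (f := M) (fun i _ => hM0 i) (Finset.mem_range.2 (by omega))

end Flow

section Compactification

open scoped ContDiff

variable {X : Type*} [NormedAddCommGroup X] [InnerProductSpace ℝ X]

/-- A linear map bounded by a multiple of `‖T x‖` vanishes on `ker T`, hence factors through `T`. -/
theorem exists_linear_factor [FiniteDimensional ℝ X] {Z : Type*} [NormedAddCommGroup Z]
    [NormedSpace ℝ Z] (T : X →L[ℝ] X) (f : X →L[ℝ] Z) {K : ℝ}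
    (h : ∀ x, ‖f x‖ ≤ K * ‖T x‖) : ∃ g : X →L[ℝ] Z, ∀ x, g (T x) = f x := by
  obtain ⟨s, hs⟩ := T.toLinearMap.rangeRestrict.exists_rightInverse_of_surjective
    T.toLinearMap.range_rangeRestrict
  obtain ⟨s', hs'⟩ := s.exists_extend
  refine ⟨f.comp (LinearMap.toContinuousLinearMap s'), fun x => ?_⟩
  have h1 : s' (T x) = s ⟨T x, ⟨x, rfl⟩⟩ := DFunLike.congr_fun hs' ⟨T x, ⟨x, rfl⟩⟩
  have h2 : T (s' (T x)) = T x := by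
    rw [h1]; exact congrArg Subtype.val (DFunLike.congr_fun hs ⟨T x, ⟨x, rfl⟩⟩)
  have h3 := h (s' (T x) - x)
  rw [map_sub, map_sub, h2, sub_self, norm_zero, mul_zero] at h3
  exact sub_eq_zero.1 (norm_le_zero_iff.1 h3)

/-- The point `(1, z) / √(1 + ‖z‖²)` of the half-sphere that compactifies the space of `z`. -/
noncomputable def halfSphere (z : X) : ℝ × X :=
  ((√(1 + ‖z‖ ^ 2))⁻¹, (√(1 + ‖z‖ ^ 2))⁻¹ • z)

theorem norm_halfSphere_le (z : X) : ‖halfSphere z‖ ≤ 1 := by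
  have h0 : 0 < √(1 + ‖z‖ ^ 2) := by positivity
  have h1 : 1 ≤ √(1 + ‖z‖ ^ 2) := Real.one_le_sqrt.2 (by linarith [sq_nonneg ‖z‖])
  rw [halfSphere, Prod.norm_mk, norm_smul, Real.norm_of_nonneg (inv_nonneg.2 h0.le)]
  refine max_le (inv_le_one_of_one_le₀ h1) ?_
  rw [inv_mul_le_iff₀ h0, mul_one]
  exact Real.le_sqrt_of_sq_le (by linarith)

/-- The vector field that `ż = L z + u β` induces on the half-sphere; it is polynomial. -/
noncomputable def halfSphereField (L : X →L[ℝ] X) (β : X) (y : ℝ × X) (u : ℝ) : ℝ × X :=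
  (-(y.1 * (inner ℝ y.2 (L y.2) + y.1 * u * inner ℝ y.2 β)),
    L y.2 + (y.1 * u) • β - (inner ℝ y.2 (L y.2) + y.1 * u * inner ℝ y.2 β) • y.2)

theorem hasDerivWithinAt_halfSphere {L : X →L[ℝ] X} {β : X} {z : ℝ → X} {u : ℝ} {s : Set ℝ} {t : ℝ}
    (hz : HasDerivWithinAt z (L (z t) + u • β) s t) :
    HasDerivWithinAt (fun t => halfSphere (z t)) (halfSphereField L β (halfSphere (z t)) u) s t := by
  have h0 : 0 < √(1 + ‖z t‖ ^ 2) := by positivity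
  have h1 : HasDerivWithinAt (fun t => (√(1 + ‖z t‖ ^ 2))⁻¹)
      (halfSphereField L β (halfSphere (z t)) u).1 s t := by
    refine (((hz.norm_sq.const_add 1).sqrt (by positivity)).inv h0.ne').congr_deriv ?_
    simp only [halfSphereField, halfSphere, inner_add_right, inner_smul_right, inner_smul_left,
      map_smul]
    field_simp
    simp
    linear_combination
      (-(u * inner ℝ (z t) β) - inner ℝ (z t) (L (z t))) * (mul_inv_cancel₀ h0.ne').symm
  refine (h1.prodMk (h1.smul hz)).congr_deriv ?_
  refine Prod.ext rfl ?_
  simp only [halfSphereField, halfSphere, map_smul, smul_add, smul_smul]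
  module

theorem contDiff_halfSphereField (L : X →L[ℝ] X) (β : X) :
    ContDiff ℝ ∞ fun p : (ℝ × X) × ℝ => halfSphereField L β p.1 p.2 := by
  unfold halfSphereField
  have h1 : ContDiff ℝ ∞ fun p : (ℝ × X) × ℝ => p.1.1 := contDiff_fst.fst
  have h2 : ContDiff ℝ ∞ fun p : (ℝ × X) × ℝ => p.1.2 := contDiff_fst.snd
  have h3 : ContDiff ℝ ∞ fun p : (ℝ × X) × ℝ => p.2 := contDiff_snd
  have h4 := L.contDiff.comp h2
  have h5 := (h2.inner ℝ h4).add ((h1.mul h3).mul (h2.inner ℝ (contDiff_const (c := β))))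
  exact (h1.mul h5).neg.prodMk ((h4.add ((h1.mul h3).smul contDiff_const)).sub (h5.smul h2))

end Compactification

section Final

open Matrix
open scoped ContDiff

variable {n m : ℕ}

local notation "𝓔" => EuclideanSpace ℝ (Fin n)

theorem contDiff_satFeedback (k : Fin m → 𝓔) (T : Fin m → Matrix (Fin n) (Fin n) ℝ) (p : ℕ) :
    ContDiff ℝ p (satFeedback k T) := by
  change ContDiff ℝ p fun x => - ∑ j, inner ℝ (k j) x / √(1 + ‖toEuclideanCLM (𝕜 := ℝ) (T j) x‖ ^ 2)
  refine (ContDiff.sum fun j _ => ?_).neg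
  refine (contDiff_const.inner ℝ contDiff_id).div
    ((contDiff_const.add ((toEuclideanCLM (𝕜 := ℝ) (T j)).contDiff.norm_sq ℝ)).sqrt
      fun x => by positivity) fun x => by positivity

/-- The control signal is a linear observable of the compactified states `T_j x`, which solve a
smooth autonomous system; hence all its derivatives are bounded uniformly over trajectories. -/
theorem IsGoodDesign.exists_derivative_bound {A : Matrix (Fin n) (Fin n) ℝ} {b : 𝓔}
    {k : Fin m → 𝓔} {T : Fin m → Matrix (Fin n) (Fin n) ℝ} (h : IsGoodDesign A b k T) (p : ℕ) :
    ∃ M, 0 ≤ M ∧ ∀ x : ℝ → 𝓔, IsTrajectory (closedLoop (linearSystem A b) (satFeedback k T)) x →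
      ContDiffOn ℝ p (fun t => satFeedback k T (x t)) (Set.Ici 0) ∧
      ∀ i ≤ p, ∀ t, 0 ≤ t →
        ‖iteratedDerivWithin i (fun t => satFeedback k T (x t)) (Set.Ici 0) t‖ ≤ M := by
  obtain ⟨K, hK, hfac⟩ := h.factor
  have hL : ∀ j, ∃ L : 𝓔 →L[ℝ] 𝓔, ∀ x, L (toEuclideanCLM (𝕜 := ℝ) (T j) x) =
      toEuclideanCLM (𝕜 := ℝ) (T j) (toEuclideanCLM (𝕜 := ℝ) A x) := fun j =>
    exists_linear_factor _ ((toEuclideanCLM (𝕜 := ℝ) (T j)).comp (toEuclideanCLM (𝕜 := ℝ) A))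
      fun x => (hfac j x).1
  have hl : ∀ j, ∃ l : 𝓔 →L[ℝ] ℝ, ∀ x, l (toEuclideanCLM (𝕜 := ℝ) (T j) x) = inner ℝ (k j) x :=
    fun j => exists_linear_factor _ (innerSL ℝ (k j)) fun x => (hfac j x).2
  choose L hL using hL
  choose l hl using hl
  let Φ : (Fin m → ℝ × 𝓔) → ℝ := fun y => -∑ j, l j (y j).2
  let G : (Fin m → ℝ × 𝓔) → (Fin m → ℝ × 𝓔) := fun y j =>
    halfSphereField (L j) (toEuclideanCLM (𝕜 := ℝ) (T j) b) (y j) (Φ y)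
  have hΦ : ContDiff ℝ ∞ Φ :=
    (ContDiff.sum fun j _ => (l j).contDiff.comp (contDiff_apply ℝ (ℝ × 𝓔) j).snd).neg
  have hG : ContDiff ℝ ∞ G := contDiff_pi.2 fun j =>
    (contDiff_halfSphereField _ _).comp ((contDiff_apply ℝ (ℝ × 𝓔) j).prodMk hΦ)
  let q : 𝓔 → Fin m → ℝ × 𝓔 := fun x j => halfSphere (toEuclideanCLM (𝕜 := ℝ) (T j) x)
  have hΦq : ∀ x, satFeedback k T x = Φ (q x) := by
    intro x
    rw [satFeedback_apply]
    simp only [Φ, q, halfSphere, map_smul, hl, smul_eq_mul]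
    congr 1
    exact Finset.sum_congr rfl fun j _ => div_eq_inv_mul _ _
  obtain ⟨M, hM0, hM⟩ := exists_bound_iteratedDerivWithin hG hΦ p
  refine ⟨M, hM0, fun x hx => ?_⟩
  have hq : IsTrajectory G fun t => q (x t) := by
    intro t ht
    refine hasDerivWithinAt_pi.2 fun j => ?_
    have h1 := (toEuclideanCLM (𝕜 := ℝ) (T j)).hasFDerivAt.comp_hasDerivWithinAt t (hx t ht)
    rw [closedLoop_linearSystem_apply, map_add, map_smul, ← hL, hΦq] at h1
    exact hasDerivWithinAt_halfSphere h1
  simp only [hΦq]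
  exact ⟨contDiffOn_comp_trajectory hG hq hΦ p, hM _ hq fun t _ =>
    (pi_norm_le_iff_of_nonneg zero_le_one).2 fun j => norm_halfSphere_le _⟩

theorem IsTrajectory.smul_satFeedback {A : Matrix (Fin n) (Fin n) ℝ} {b : 𝓔} {k : Fin m → 𝓔}
    {T : Fin m → Matrix (Fin n) (Fin n) ℝ} {τ : ℝ} (hτ : 0 < τ) {x : ℝ → 𝓔}
    (hx : IsTrajectory (closedLoop (linearSystem A b) (satFeedback k fun j => τ • T j)) x) :
    IsTrajectory (closedLoop (linearSystem A b) (satFeedback k T)) fun t => τ • x t := by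
  intro t ht
  refine ((hx t ht).const_smul τ).congr_deriv ?_
  rw [closedLoop_linearSystem_apply, closedLoop_linearSystem_apply, satFeedback_smul hτ, smul_add,
    smul_smul, ← mul_assoc, mul_inv_cancel₀ hτ.ne', one_mul, map_smul]

/-- Replacing `T_j` by `τ T_j` divides the control signal and all its derivatives by `τ`. -/
theorem IsGoodDesign.exists_isPBoundedFeedback {A : Matrix (Fin n) (Fin n) ℝ} {b : 𝓔}
    {k : Fin m → 𝓔} {T : Fin m → Matrix (Fin n) (Fin n) ℝ} (h : IsGoodDesign A b k T) (p : ℕ)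
    (R : Fin (p + 1) → ℝ) (hR : ∀ j, 0 < R j) : ∃ τ : ℝ, 0 < τ ∧
      IsPBoundedFeedback (linearSystem A b) (satFeedback k fun j => τ • T j) p R := by
  obtain ⟨M, hM0, hM⟩ := h.exists_derivative_bound p
  have hsum : 0 ≤ ∑ j, M / R j := Finset.sum_nonneg fun j _ => div_nonneg hM0 (hR j).le
  obtain ⟨τ, hτ, hτR⟩ : ∃ τ : ℝ, 0 < τ ∧ ∀ j, M ≤ τ * R j := by
    refine ⟨1 + ∑ j, M / R j, by positivity, fun j => ?_⟩
    rw [← div_le_iff₀ (hR j)]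
    have := Finset.single_le_sum (f := fun j => M / R j)
      (fun j _ => div_nonneg hM0 (hR j).le) (Finset.mem_univ j)
    linarith
  refine ⟨τ, hτ, contDiff_satFeedback _ _ p, fun x hx => ?_⟩
  obtain ⟨h1, h2⟩ := hM _ (hx.smul_satFeedback hτ)
  have e : (fun t => satFeedback k (fun j => τ • T j) (x t)) =
      τ⁻¹ • fun t => satFeedback k T (τ • x t) := by
    ext t; rw [satFeedback_smul hτ]; rfl
  rw [e]
  refine ⟨contDiffOn_const.smul h1, fun j t ht => ?_⟩
  rw [iteratedDerivWithin_const_smul_field, norm_smul, norm_inv, Real.norm_of_nonneg hτ.le,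
    inv_mul_le_iff₀ hτ]
  exact (h2 j (Nat.lt_succ_iff.1 j.2) t ht).trans (hτR j)

end Final

end BoundedDerivatives

theorem theorem1 (n : ℕ) (hn : 0 < n)
    (A : Matrix (Fin n) (Fin n) ℝ) (b : EuclideanSpace ℝ (Fin n))
    (hA : BoundedDerivatives.NoEigenvalueWithPosRe A)
    (hAb : BoundedDerivatives.IsStabilizable A b)
    (p : ℕ) (R : Fin (p + 1) → ℝ) (hR : ∀ j, 0 < R j) :
    ∃ (k : Fin (BoundedDerivatives.numCriticalBlocks A) → EuclideanSpace ℝ (Fin n))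
      (T : Fin (BoundedDerivatives.numCriticalBlocks A) → Matrix (Fin n) (Fin n) ℝ),
      BoundedDerivatives.IsPBoundedFeedback (BoundedDerivatives.linearSystem A b)
        (BoundedDerivatives.satFeedback k T) p R ∧
      BoundedDerivatives.IsSISSLStabilizingFeedback (BoundedDerivatives.linearSystem A b)
        (BoundedDerivatives.satFeedback k T) := by
  obtain ⟨k, T, h⟩ := BoundedDerivatives.exists_isGoodDesign hA hAb
  obtain ⟨τ, hτ, hbd⟩ := h.exists_isPBoundedFeedback p R hR
  exact ⟨k, fun j => τ • T j, hbd, (h.smul hτ).isSISSLStabilizingFeedback⟩
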